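/- Identify $\mathbb R^n$ with its dual by the standard inner product; write $K^\circ=\{p:\langle p,q\rangle\le 1\ \forall q\in K\}$ and $\|q\|_T=\max_{p\in T}\langle p,q\rangle$, so that $\|\cdot\|_{K^\circ}$ has unit ball $K$ for a symmetric convex body $K$. Hanner polytopes are the bodies obtained from the segment $[-1,1]\subset\mathbb R^1$ by repeatedly forming, from $K\subset\mathbb R^k$ and $L\subset\mathbb R^l$, the bodies $K\oplus_1L$ and $K\oplus_\infty L$ in $\mathbb R^{k+l}$, which are the unit balls of the sum, respectively the maximum, of the norms with unit balls $K$ and $L$. A point $q\in\partial K$ lies in a smooth piece of $\partial K$ if $\|\cdot\|_{K^\circ}$ is differentiable at $q$ (for a polytope: $q$ is in the relative interior of a facet); then $n_K(q)=d\|q\|_{K^\circ}$ is the outer normal. A classical billiard trajectory in $K\times T$ consists of points $q_i$ in smooth pieces of $\partial K$ and momenta $p_i$ in smooth pieces of $\partial T$ ($i\ge 1$) such that, for all $i$, $$p_{i+1}-p_i=-\lambda_i\,n_K(q_i),\qquad q_{i+1}-q_i=\mu_i\,n_T(p_{i+1}),\qquad \lambda_i,\mu_i>0,$$ and $q\mapsto\|q_{i+2}-q\|_T+\|q-q_i\|_T$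 restricted to $\partial K$ has a local minimum at $q_{i+1}$. It is closed with $m\ge2$ bounces if $(q_{i+m},p_{i+m})=(q_i,p_i)$ for all $i$; its length is then $\sum_{i=1}^m\|q_{i+1}-q_i\|_T$, and it is simple if for no $0<d<m$ one has $q_{i+d}=q_i$ for all $i$ (the route is not passed several times). **Statement.** Let $H\subset\mathbb R^n$ be a Hanner polytope. Consider the initial positions $(q_1,p_1)\in\partial H\times\partial H^\circ$ such that $q_1$ lies in a smooth piece of $\partial H$ and the vector $-n_H(q_1)$, drawn from $p_1$, points into the interior of $H^\circ$ (that is, $p_1-t\,n_H(q_1)\in\operatorname{int}H^\circ$ for all small $t>0$). Almost all of them, with respect to the $(2n-2)$-dimensional surface measure on $\partial H\times\partial H^\circ$, generate a closed simple classical billiard trajectory of length $4$ in $H\times H^\circ$: there is exactly one classical billiard trajectory in $H\times H^\circ$ starting from $(q_1,p_1)$, and it is closed with some number $m\ge 2$ of bounces for which it is simple and has length $4$. -/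

import Mathlib

open MeasureTheory Set

namespace Billiard

noncomputable section

variable {n : ℕ}

/-- The polar body `K° = {p | ⟨p, q⟩ ≤ 1 for all q ∈ K}`, with `ℝⁿ` identified with its dual
through the standard inner product. -/
def polarBody (K : Set (EuclideanSpace ℝ (Fin n))) : Set (EuclideanSpace ℝ (Fin n)) :=
  {p | ∀ q ∈ K, inner ℝ p q ≤ 1}

/-- The (possibly non-symmetric) norm `‖q‖_T = max {⟨p, q⟩ | p ∈ T}`, whose unit ball is `T°`. -/
def bodyNorm (T : Set (EuclideanSpace ℝ (Fin n))) (q : EuclideanSpace ℝ (Fin n)) : ℝ :=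
  sSup ((fun p => inner ℝ p q) '' T)

/-- The point `q` lies in a smooth piece of `∂K`: it is a boundary point at which the norm
`‖·‖_{K°}`, whose unit ball is `K`, is differentiable. For a polytope this says that `q` lies in
the relative interior of a facet. -/
def IsSmoothBoundaryPoint (K : Set (EuclideanSpace ℝ (Fin n)))
    (q : EuclideanSpace ℝ (Fin n)) : Prop :=
  q ∈ frontier K ∧ DifferentiableAt ℝ (bodyNorm (polarBody K)) q

/-- The outer normal `n_K(q) = d‖q‖_{K°}` at a point of a smooth piece of `∂K`. -/
def outerNormal (K : Set (EuclideanSpace ℝ (Fin n))) (q : EuclideanSpace ℝ (Fin n)) :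
    EuclideanSpace ℝ (Fin n) :=
  gradient (bodyNorm (polarBody K)) q

/-- The polygonal line `a → b → c` has a billiard reflection at `b ∈ ∂K`: the length functional
`q ↦ ‖c - q‖_T + ‖q - a‖_T` has at `b` a local minimum under the constraint `q ∈ ∂K`. -/
def HasBilliardReflection (K T : Set (EuclideanSpace ℝ (Fin n)))
    (a b c : EuclideanSpace ℝ (Fin n)) : Prop :=
  a ∈ K ∧ b ∈ frontier K ∧ c ∈ K ∧
    IsLocalMinOn (fun q => bodyNorm T (c - q) + bodyNorm T (q - a)) (frontier K) b

/-- The sequences `q₀, q₁, …` (coordinates) and `p₀, p₁, …` (momenta) form a classical billiard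
trajectory in the configuration `K × T`. Here `p i` is the momentum before, and `p (i + 1)` the
momentum after, the reflection at `q i`; between `q i` and `q (i + 1)` the point moves with the
velocity `n_T(p (i + 1)) = d‖p (i + 1)‖_{T°}`. -/
structure IsClassicalTrajectory (K T : Set (EuclideanSpace ℝ (Fin n)))
    (q p : ℕ → EuclideanSpace ℝ (Fin n)) : Prop where
  smooth_coordinate : ∀ i, IsSmoothBoundaryPoint K (q i)
  smooth_momentum : ∀ i, IsSmoothBoundaryPoint T (p i)
  momentum_change : ∀ i, ∃ c : ℝ, 0 < c ∧ p (i + 1) - p i = -(c • outerNormal K (q i))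
  coordinate_change : ∀ i, ∃ c : ℝ, 0 < c ∧ q (i + 1) - q i = c • outerNormal T (p (i + 1))
  reflection : ∀ i, HasBilliardReflection K T (q i) (q (i + 1)) (q (i + 2))

/-- The trajectory is closed, with `m ≥ 2` bounces `q 0, …, q (m - 1)`. -/
def IsClosedTrajectory (m : ℕ) (q p : ℕ → EuclideanSpace ℝ (Fin n)) : Prop :=
  2 ≤ m ∧ ∀ i, q (i + m) = q i ∧ p (i + m) = p i

/-- The closed polygonal line `q 0 → ⋯ → q (m - 1) → q 0` does not pass the same route several
times: no smaller shift preserves it. -/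
def IsSimpleTrajectory (m : ℕ) (q : ℕ → EuclideanSpace ℝ (Fin n)) : Prop :=
  ∀ d, 0 < d → d < m → ∃ i, q (i + d) ≠ q i

/-- The length of the closed polygonal line `q 0 → ⋯ → q (m - 1) → q m = q 0`, measured with
the norm `‖·‖_T`. -/
def closedLength (T : Set (EuclideanSpace ℝ (Fin n))) (m : ℕ)
    (q : ℕ → EuclideanSpace ℝ (Fin n)) : ℝ :=
  ∑ i ∈ Finset.range m, bodyNorm T (q (i + 1) - q i)

/-- The initial position `(q₀, p₀)` generates the classical trajectory `(q, p)` in `K × T`: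
this trajectory starts at `(q₀, p₀)`, and it is the only one that does. -/
def Generates (K T : Set (EuclideanSpace ℝ (Fin n))) (q₀ p₀ : EuclideanSpace ℝ (Fin n))
    (q p : ℕ → EuclideanSpace ℝ (Fin n)) : Prop :=
  (IsClassicalTrajectory K T q p ∧ q 0 = q₀ ∧ p 0 = p₀) ∧
    ∀ q' p' : ℕ → EuclideanSpace ℝ (Fin n),
      IsClassicalTrajectory K T q' p' → q' 0 = q₀ → p' 0 = p₀ → q' = q ∧ p' = p

/-- The point `q₀` lies in a smooth piece of `∂K`, the point `p₀` lies on `∂T`, and the vector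
`-n_K(q₀)`, drawn from `p₀`, points into the interior of `T`. -/
def IsAdmissiblePosition (K T : Set (EuclideanSpace ℝ (Fin n)))
    (q₀ p₀ : EuclideanSpace ℝ (Fin n)) : Prop :=
  IsSmoothBoundaryPoint K q₀ ∧ p₀ ∈ frontier T ∧
    ∃ ε : ℝ, 0 < ε ∧ ∀ t : ℝ, 0 < t → t < ε → p₀ - t • outerNormal K q₀ ∈ interior T

/-- The first `k` coordinates of a point of `ℝ^(k + l)`. -/
def firstPart {k l : ℕ} (x : EuclideanSpace ℝ (Fin (k + l))) : EuclideanSpace ℝ (Fin k) :=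
  WithLp.toLp 2 fun i => x (Fin.castAdd l i)

/-- The last `l` coordinates of a point of `ℝ^(k + l)`. -/
def lastPart {k l : ℕ} (x : EuclideanSpace ℝ (Fin (k + l))) : EuclideanSpace ℝ (Fin l) :=
  WithLp.toLp 2 fun i => x (Fin.natAdd k i)

/-- `K ⊕₁ L`: the unit ball of the sum of the norms with unit balls `K` and `L`. -/
def oneSum {k l : ℕ} (K : Set (EuclideanSpace ℝ (Fin k))) (L : Set (EuclideanSpace ℝ (Fin l))) :
    Set (EuclideanSpace ℝ (Fin (k + l))) :=
  {x | gauge K (firstPart x) + gauge L (lastPart x) ≤ 1}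

/-- `K ⊕_∞ L`: the unit ball of the maximum of the norms with unit balls `K` and `L`. -/
def infSum {k l : ℕ} (K : Set (EuclideanSpace ℝ (Fin k))) (L : Set (EuclideanSpace ℝ (Fin l))) :
    Set (EuclideanSpace ℝ (Fin (k + l))) :=
  {x | max (gauge K (firstPart x)) (gauge L (lastPart x)) ≤ 1}

/-- Hanner polytopes: the segment `[-1, 1]`, and everything obtained from it by the operations
`⊕₁` and `⊕_∞`. -/
inductive IsHannerPolytope : (n : ℕ) → Set (EuclideanSpace ℝ (Fin n)) → Prop
  | segment : IsHannerPolytope 1 {x | -1 ≤ x 0 ∧ x 0 ≤ 1}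
  | oneSum {k l : ℕ} {K : Set (EuclideanSpace ℝ (Fin k))} {L : Set (EuclideanSpace ℝ (Fin l))} :
      IsHannerPolytope k K → IsHannerPolytope l L → IsHannerPolytope (k + l) (oneSum K L)
  | infSum {k l : ℕ} {K : Set (EuclideanSpace ℝ (Fin k))} {L : Set (EuclideanSpace ℝ (Fin l))} :
      IsHannerPolytope k K → IsHannerPolytope l L → IsHannerPolytope (k + l) (infSum K L)

/-- The surface measure on `∂K × ∂T`, the `(2n - 2)`-dimensional Hausdorff measure. On each
product of two facets of polytopes it is a constant multiple of the product of the
`(n - 1)`-dimensional measures of the facets. -/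
def boundaryMeasure (K T : Set (EuclideanSpace ℝ (Fin n))) :
    Measure (EuclideanSpace ℝ (Fin n) × EuclideanSpace ℝ (Fin n)) :=
  (Measure.hausdorffMeasure (2 * (n : ℝ) - 2)).restrict (frontier K ×ˢ frontier T)

end

end Billiard

/-! A Hanner polytope and its polar are cut out by finite symmetric sets `W`, `V` of integral
normals. Call a point generic if its coordinates are linearly independent over the rationals. At a
generic point only one normal is active, and the time of the next hit is a rational combination of
the coordinates, so a bounce keeps points generic (`IsGeneric.sub_smul`). A generic admissible
position therefore never meets a nonsmooth point, and its future is determined.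

The heart is `HasAntipodalOrbits`: in dimension `n`, a generic orbit is at its antipode after
exactly `n` bounces, with half of the length run. Doing this twice closes it after `2 * n` bounces
with length 4. The proof follows the construction of Hanner polytopes. For the segment it is one
bounce. Exchanging coordinates and momenta (`IsOrbit.flip`) passes to the polar body, so only `⊕₁`
remains. There the momenta move in a product: the two components run on a common clock without
seeing each other, and a hit on a facet of one factor changes the coordinate of that factor only. An
orbit of the sum is thus two factor orbits merged by time (`IsOrbit.exists_merge`). Both factors
need the time `2 * b` to reach their antipodes, with `k` and `l` hits, which makes `k + l` bounces.

The route is simple because the antipode is at distance `2 * a` and cannot be reached on a shorter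
way. Nongeneric positions on the two boundaries lie in countably many affine subspaces of dimension
at most `2 * n - 3`, hence form a null set. -/

open MeasureTheory Set

namespace Billiard

/-! ### Generic points and orbits -/

noncomputable section

variable {n k l : ℕ}

/-- The lattice `ℤⁿ` in `ℝⁿ`. -/
def intLattice (n : ℕ) : AddSubgroup (EuclideanSpace ℝ (Fin n)) where
  carrier := {x | ∀ i, ∃ z : ℤ, x i = z}
  zero_mem' := fun _ => ⟨0, by simp⟩
  add_mem' := by
    intro x y hx hy i
    obtain ⟨a, ha⟩ := hx i
    obtain ⟨b, hb⟩ := hy i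
    exact ⟨a + b, by simp [ha, hb]⟩
  neg_mem' := by
    intro x hx i
    obtain ⟨a, ha⟩ := hx i
    exact ⟨-a, by simp [ha]⟩

theorem mem_intLattice {x : EuclideanSpace ℝ (Fin n)} :
    x ∈ intLattice n ↔ ∀ i, ∃ z : ℤ, x i = z := Iff.rfl

theorem exists_int_inner {x y : EuclideanSpace ℝ (Fin n)} (hx : x ∈ intLattice n)
    (hy : y ∈ intLattice n) : ∃ z : ℤ, inner ℝ x y = z := by
  choose a ha using mem_intLattice.1 hx
  choose b hb using mem_intLattice.1 hy
  refine ⟨∑ i, b i * a i, ?_⟩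
  simp [PiLp.inner_apply, ha, hb]

theorem inner_smul_mem_intLattice {x y z : EuclideanSpace ℝ (Fin n)} (hx : x ∈ intLattice n)
    (hy : y ∈ intLattice n) (hz : z ∈ intLattice n) : (inner ℝ x y : ℝ) • z ∈ intLattice n := by
  obtain ⟨a, ha⟩ := exists_int_inner hx hy
  intro i
  obtain ⟨b, hb⟩ := mem_intLattice.1 hz i
  exact ⟨a * b, by simp [ha, hb]⟩

/-- The coordinates of `x` are linearly independent over the rationals. -/
def IsGeneric (x : EuclideanSpace ℝ (Fin n)) : Prop :=
  ∀ c ∈ intLattice n, inner ℝ c x = 0 → c = 0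

theorem IsGeneric.neg {x : EuclideanSpace ℝ (Fin n)} (hx : IsGeneric x) : IsGeneric (-x) :=
  fun c hc h => hx c hc (by simpa using h)

/-- The linear functional `w ∈ W` is maximal at `q` among those in `W`. -/
def IsActive (W : Set (EuclideanSpace ℝ (Fin n))) (q w : EuclideanSpace ℝ (Fin n)) : Prop :=
  w ∈ W ∧ ∀ w' ∈ W, inner ℝ w' q ≤ inner ℝ w q

/-- A finite nonempty symmetric set of nonzero integral vectors. -/
structure IsVertexSet (W : Set (EuclideanSpace ℝ (Fin n))) : Prop where
  finite : W.Finite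
  nonempty : W.Nonempty
  neg_mem : ∀ w ∈ W, -w ∈ W
  integral : ∀ w ∈ W, w ∈ intLattice n
  ne_zero : ∀ w ∈ W, w ≠ 0

/-- `W` and `V` are the vertex sets of a pair of polar bodies. -/
structure IsPolarPair (W V : Set (EuclideanSpace ℝ (Fin n))) : Prop where
  left : IsVertexSet W
  right : IsVertexSet V
  inner_le_one : ∀ w ∈ W, ∀ v ∈ V, inner ℝ w v ≤ 1
  -- A Hölder inequality with arbitrary bounds in place of norms; taking one bound to be 0 shows
  -- that the bodies are bounded.
  inner_le_mul : ∀ q p a b, (∀ w ∈ W, inner ℝ w q ≤ a) → (∀ v ∈ V, inner ℝ v p ≤ b) →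
    inner ℝ p q ≤ a * b

theorem IsPolarPair.symm {W V : Set (EuclideanSpace ℝ (Fin n))} (h : IsPolarPair W V) :
    IsPolarPair V W where
  left := h.right
  right := h.left
  inner_le_one := fun w hw v hv => by
    rw [real_inner_comm]
    exact h.inner_le_one v hv w hw
  inner_le_mul := fun q p a b hq hp => by
    rw [real_inner_comm, mul_comm]
    exact h.inner_le_mul p q b a hp hq

theorem IsActive.neg {W : Set (EuclideanSpace ℝ (Fin n))} (hW : IsVertexSet W)
    {q w : EuclideanSpace ℝ (Fin n)} (h : IsActive W q w) : IsActive W (-q) (-w) := by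
  refine ⟨hW.neg_mem w h.1, fun w' hw' => ?_⟩
  have := h.2 (-w') (hW.neg_mem w' hw')
  simpa using this

theorem IsVertexSet.exists_isActive {W : Set (EuclideanSpace ℝ (Fin n))} (hW : IsVertexSet W)
    (q : EuclideanSpace ℝ (Fin n)) : ∃ w, IsActive W q w := by
  obtain ⟨w, hw, h⟩ := Set.exists_max_image W (fun w => (inner ℝ w q : ℝ)) hW.finite hW.nonempty
  exact ⟨w, hw, h⟩

theorem IsActive.nonneg {W : Set (EuclideanSpace ℝ (Fin n))} (hW : IsVertexSet W)
    {q w : EuclideanSpace ℝ (Fin n)} (h : IsActive W q w) : 0 ≤ (inner ℝ w q : ℝ) := by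
  have := h.2 (-w) (hW.neg_mem w h.1)
  rw [inner_neg_left] at this
  linarith

theorem IsGeneric.eq_of_inner_eq {q u w : EuclideanSpace ℝ (Fin n)} (hq : IsGeneric q)
    (hu : u ∈ intLattice n) (hw : w ∈ intLattice n) (h : (inner ℝ u q : ℝ) = inner ℝ w q) :
    u = w := by
  refine sub_eq_zero.1 (hq (u - w) (sub_mem hu hw) ?_)
  rw [inner_sub_left, h, sub_self]

theorem IsActive.unique {W : Set (EuclideanSpace ℝ (Fin n))} (hW : IsVertexSet W)
    {q u w : EuclideanSpace ℝ (Fin n)} (hq : IsGeneric q) (hu : IsActive W q u)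
    (hw : IsActive W q w) : u = w :=
  hq.eq_of_inner_eq (hW.integral u hu.1) (hW.integral w hw.1)
    (le_antisymm (hw.2 u hu.1) (hu.2 w hw.1))

theorem IsActive.pos {W : Set (EuclideanSpace ℝ (Fin n))} (hW : IsVertexSet W)
    {q w : EuclideanSpace ℝ (Fin n)} (hq : IsGeneric q) (h : IsActive W q w) :
    0 < (inner ℝ w q : ℝ) :=
  lt_of_le_of_ne (h.nonneg hW) fun h0 =>
    hW.ne_zero w h.1 (hq w (hW.integral w h.1) h0.symm)

/-- The first exit of a ray from a polytope. -/
theorem exists_exit {V : Set (EuclideanSpace ℝ (Fin n))} (hV : V.Finite)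
    {p w : EuclideanSpace ℝ (Fin n)} {b : ℝ} (hp : ∀ u ∈ V, inner ℝ u p ≤ b)
    (hp' : ∀ u ∈ V, inner ℝ u w < (0 : ℝ) → inner ℝ u p < b)
    (hex : ∃ u ∈ V, inner ℝ u w < (0 : ℝ)) :
    ∃ t : ℝ, 0 < t ∧ ∃ v ∈ V, inner ℝ v w < (0 : ℝ) ∧ inner ℝ v (p - t • w) = b ∧
      ∀ u ∈ V, inner ℝ u (p - t • w) ≤ b := by
  obtain ⟨v, ⟨hv, hvw⟩, hmin⟩ := Set.exists_min_image {u ∈ V | inner ℝ u w < (0 : ℝ)}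
    (fun u => (b - inner ℝ u p) / (-inner ℝ u w)) (hV.subset (sep_subset _ _)) hex
  refine ⟨(b - inner ℝ v p) / (-inner ℝ v w),
    div_pos (sub_pos.2 (hp' v hv hvw)) (by linarith), v, hv, hvw, ?_, ?_⟩
  · rw [inner_sub_right, inner_smul_right]
    have : (inner ℝ v w : ℝ) ≠ 0 := hvw.ne
    field_simp
    ring
  · intro u hu
    rw [inner_sub_right, inner_smul_right]
    have ht : 0 < (b - inner ℝ v p) / (-inner ℝ v w) :=
      div_pos (sub_pos.2 (hp' v hv hvw)) (by linarith)
    rcases lt_or_ge (inner ℝ u w : ℝ) 0 with h | h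
    · have h1 := hmin u ⟨hu, h⟩
      rw [le_div_iff₀ (by linarith)] at h1
      linarith
    · have := mul_nonneg ht.le h
      have := hp u hu
      linarith

theorem le_of_exit {v p w : EuclideanSpace ℝ (Fin n)} {b s t : ℝ}
    (hv : inner ℝ v w < (0 : ℝ)) (hs : inner ℝ v (p - s • w) = b)
    (ht : inner ℝ v (p - t • w) ≤ b) : t ≤ s := by
  rw [inner_sub_right, inner_smul_right] at hs ht
  nlinarith

/-- The condition `ht` makes `t` the quotient of `⟨v' - v, p⟩` by `⟨v', w⟩`. If an integral `c`
annihilates the new point, clearing this denominator gives an integral vector annihilating `p`,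
which must vanish; pairing it with `w` forces `⟨c, w⟩ = 0`, and then `c = 0`. -/
theorem IsGeneric.sub_smul {p v v' w : EuclideanSpace ℝ (Fin n)} (hp : IsGeneric p)
    (hv : v ∈ intLattice n) (hv' : v' ∈ intLattice n) (hw : w ∈ intLattice n)
    (h : (inner ℝ v w : ℝ) ≠ 0) (h' : (inner ℝ v' w : ℝ) ≠ 0) {t : ℝ}
    (ht : (inner ℝ v' (p - t • w) : ℝ) = inner ℝ v p) : IsGeneric (p - t • w) := by
  intro c hc h0
  rw [inner_sub_right, inner_smul_right] at ht h0
  have h1 : (inner ℝ v' w : ℝ) • c - (inner ℝ c w : ℝ) • (v' - v) = 0 := by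
    refine hp _ (sub_mem (inner_smul_mem_intLattice hv' hw hc)
      (inner_smul_mem_intLattice hc hw (sub_mem hv' hv))) ?_
    simp only [inner_sub_left, inner_smul_left, RCLike.conj_to_real]
    linear_combination (inner ℝ v' w : ℝ) * h0 - (inner ℝ c w : ℝ) * ht
  have h2 : (inner ℝ c w : ℝ) = 0 := by
    have := congrArg (fun x => (inner ℝ x w : ℝ)) h1
    simp only [inner_sub_left, inner_smul_left, RCLike.conj_to_real, inner_zero_left] at this
    refine (mul_eq_zero.1 (?_ : (inner ℝ c w : ℝ) * inner ℝ v w = 0)).resolve_right h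
    linear_combination this
  rw [h2, zero_smul, sub_zero] at h1
  exact (smul_eq_zero.1 h1).resolve_left h'

/-- One half step of the billiard. -/
theorem exists_half_step {V : Set (EuclideanSpace ℝ (Fin n))} (hV : IsVertexSet V)
    {p v w : EuclideanSpace ℝ (Fin n)} (hp : IsGeneric p) (hv : IsActive V p v)
    (hw : w ∈ intLattice n) (hvw : 0 < (inner ℝ v w : ℝ)) :
    ∃ t : ℝ, ∃ v', 0 < t ∧ IsActive V (p - t • w) v' ∧
      inner ℝ v' (p - t • w) = (inner ℝ v p : ℝ) ∧ inner ℝ v' w < (0 : ℝ) ∧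
      IsGeneric (p - t • w) := by
  obtain ⟨t, ht, v', hv', h1, h2, h3⟩ := exists_exit hV.finite (p := p) (w := w) hv.2
    -- By genericity only `v` is active at `p`, and `v` has the wrong sign against `w`: no facet
    -- that the ray can leave through is touched at the start.
    (fun u hu h => lt_of_le_of_ne (hv.2 u hu) fun h0 => by
      have := hp.eq_of_inner_eq (hV.integral u hu) (hV.integral v hv.1) h0
      subst this
      linarith)
    ⟨-v, hV.neg_mem v hv.1, by rw [inner_neg_left]; linarith⟩
  exact ⟨t, v', ht, ⟨hv', fun u hu => (h3 u hu).trans_eq h2.symm⟩, h2, h1,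
    hp.sub_smul (hV.integral v hv.1) (hV.integral v' hv') hw hvw.ne' h1.ne h2⟩

/-- A billiard orbit through generic points: `w i` and `v i` are the normals at `q i` and `p i`,
and the norms of `q i` and `p i` are `a` and `b`. -/
structure IsOrbit (W V : Set (EuclideanSpace ℝ (Fin n))) (a b : ℝ)
    (q p w v : ℕ → EuclideanSpace ℝ (Fin n)) (lam mu : ℕ → ℝ) : Prop where
  generic_q : ∀ i, IsGeneric (q i)
  generic_p : ∀ i, IsGeneric (p i)
  active_q : ∀ i, IsActive W (q i) (w i)
  active_p : ∀ i, IsActive V (p i) (v i)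
  -- The levels are not normalised to 1: the two parts of a point at level `a` of a `⊕₁`-sum lie at
  -- levels that only add up to `a`.
  level_q : ∀ i, inner ℝ (w i) (q i) = a
  level_p : ∀ i, inner ℝ (v i) (p i) = b
  lam_pos : ∀ i, 0 < lam i
  mu_pos : ∀ i, 0 < mu i
  p_succ : ∀ i, p (i + 1) = p i - lam i • w i
  q_succ : ∀ i, q (i + 1) = q i + mu i • v (i + 1)
  pos : ∀ i, 0 < (inner ℝ (v i) (w i) : ℝ)
  neg : ∀ i, inner ℝ (v (i + 1)) (w i) < (0 : ℝ)

theorem exists_isOrbit {W V : Set (EuclideanSpace ℝ (Fin n))} (hW : IsVertexSet W)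
    (hV : IsVertexSet V) {q₀ p₀ w₀ v₀ : EuclideanSpace ℝ (Fin n)} (hq : IsGeneric q₀)
    (hp : IsGeneric p₀) (hw : IsActive W q₀ w₀) (hv : IsActive V p₀ v₀)
    (hvw : 0 < (inner ℝ v₀ w₀ : ℝ)) :
    ∃ q p w v lam mu, IsOrbit W V (inner ℝ w₀ q₀) (inner ℝ v₀ p₀) q p w v lam mu ∧
      q 0 = q₀ ∧ p 0 = p₀ ∧ w 0 = w₀ ∧ v 0 = v₀ := by
  let E := EuclideanSpace ℝ (Fin n)
  let S := {s : (E × E) × E × E // IsGeneric s.1.1 ∧ IsGeneric s.1.2 ∧ IsActive W s.1.1 s.2.1 ∧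
    IsActive V s.1.2 s.2.2 ∧ inner ℝ s.2.1 s.1.1 = (inner ℝ w₀ q₀ : ℝ) ∧
    inner ℝ s.2.2 s.1.2 = (inner ℝ v₀ p₀ : ℝ) ∧ 0 < (inner ℝ s.2.2 s.2.1 : ℝ)}
  have step : ∀ s : S, ∃ (s' : S) (x y : ℝ), 0 < x ∧ 0 < y ∧
      s'.1.1.2 = s.1.1.2 - x • s.1.2.1 ∧ s'.1.1.1 = s.1.1.1 + y • s'.1.2.2 ∧
      inner ℝ s'.1.2.2 s.1.2.1 < (0 : ℝ) := by
    rintro ⟨⟨⟨q, p⟩, w, v⟩, h1, h2, h3, h4, h5, h6, h7⟩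
    simp only at h1 h2 h3 h4 h5 h6 h7 ⊢
    -- A full step is a half step of the momentum along `-w` and then one of the coordinate along
    -- `v'`. The sign produced by each half step is the one that the next half step needs.
    obtain ⟨x, v', hx, a1, a2, a3, a4⟩ := exists_half_step hV h2 h4 (hW.integral w h3.1) h7
    obtain ⟨y, w', hy, b1, b2, b3, b4⟩ := exists_half_step hW h1 h3
      (neg_mem (hV.integral v' a1.1))
      (by rw [inner_neg_right, real_inner_comm]; linarith)
    rw [smul_neg, sub_neg_eq_add] at b1 b2 b4
    refine ⟨⟨((q + y • v', p - x • w), w', v'), b4, a4, b1, a1, b2.trans h5, a2.trans h6, ?_⟩,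
      x, y, hx, hy, rfl, rfl, a3⟩
    rw [inner_neg_right, real_inner_comm] at b3
    simpa using b3
  choose f x y hx hy hf1 hf2 hf3 using step
  let s₀ : S := ⟨((q₀, p₀), w₀, v₀), hq, hp, hw, hv, rfl, rfl, hvw⟩
  let s : ℕ → S := fun i => f^[i] s₀
  have hs : ∀ i, s (i + 1) = f (s i) := fun i => Function.iterate_succ_apply' f i s₀
  refine ⟨fun i => (s i).1.1.1, fun i => (s i).1.1.2, fun i => (s i).1.2.1, fun i => (s i).1.2.2,
    fun i => x (s i), fun i => y (s i), ?_, rfl, rfl, rfl, rfl⟩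
  exact
    { generic_q := fun i => (s i).2.1
      generic_p := fun i => (s i).2.2.1
      active_q := fun i => (s i).2.2.2.1
      active_p := fun i => (s i).2.2.2.2.1
      level_q := fun i => (s i).2.2.2.2.2.1
      level_p := fun i => (s i).2.2.2.2.2.2.1
      lam_pos := fun i => hx _
      mu_pos := fun i => hy _
      p_succ := fun i => by simp only [hs]; exact hf1 _
      q_succ := fun i => by simp only [hs]; exact hf2 _
      pos := fun i => (s i).2.2.2.2.2.2.2
      neg := fun i => by simp only [hs]; exact hf3 _ }

/-! ### Symmetries and action of orbits -/

namespace IsOrbit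

variable {W V : Set (EuclideanSpace ℝ (Fin n))} {a b : ℝ}
  {q p w v : ℕ → EuclideanSpace ℝ (Fin n)} {lam mu : ℕ → ℝ}

theorem shift (h : IsOrbit W V a b q p w v lam mu) (j : ℕ) :
    IsOrbit W V a b (fun i => q (i + j)) (fun i => p (i + j)) (fun i => w (i + j))
      (fun i => v (i + j)) (fun i => lam (i + j)) (fun i => mu (i + j)) where
  generic_q := fun i => h.generic_q _
  generic_p := fun i => h.generic_p _
  active_q := fun i => h.active_q _
  active_p := fun i => h.active_p _
  level_q := fun i => h.level_q _
  level_p := fun i => h.level_p _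
  lam_pos := fun i => h.lam_pos _
  mu_pos := fun i => h.mu_pos _
  p_succ := fun i => by simp only [add_right_comm i 1 j]; exact h.p_succ _
  q_succ := fun i => by simp only [add_right_comm i 1 j]; exact h.q_succ _
  pos := fun i => h.pos _
  neg := fun i => by simp only [add_right_comm i 1 j]; exact h.neg _

/-- Exchanging the roles of coordinates and momenta. -/
theorem flip (hW : IsVertexSet W) (h : IsOrbit W V a b q p w v lam mu) :
    IsOrbit V W b a (fun i => p (i + 1)) (fun i => -q i) (fun i => v (i + 1)) (fun i => -w i)
      mu (fun i => lam (i + 1)) where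
  generic_q := fun i => h.generic_p _
  generic_p := fun i => (h.generic_q i).neg
  active_q := fun i => h.active_p _
  active_p := fun i => (h.active_q i).neg hW
  level_q := fun i => h.level_p _
  level_p := fun i => by rw [inner_neg_neg]; exact h.level_q i
  lam_pos := fun i => h.mu_pos _
  mu_pos := fun i => h.lam_pos _
  p_succ := fun i => by rw [h.q_succ]; abel
  q_succ := fun i => by rw [h.p_succ (i + 1), smul_neg]; abel
  pos := fun i => by
    have := h.neg i
    rw [inner_neg_left, real_inner_comm]
    linarith
  neg := fun i => by
    have := h.pos (i + 1)
    rw [inner_neg_left, real_inner_comm]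
    linarith

theorem level_q_pos (hW : IsVertexSet W) (h : IsOrbit W V a b q p w v lam mu) : 0 < a := by
  rw [← h.level_q 0]
  exact (h.active_q 0).pos hW (h.generic_q 0)

theorem level_p_pos (hV : IsVertexSet V) (h : IsOrbit W V a b q p w v lam mu) : 0 < b := by
  rw [← h.level_p 0]
  exact (h.active_p 0).pos hV (h.generic_p 0)

/-- Summation by parts for the action. -/
theorem sum_action (h : IsOrbit W V a b q p w v lam mu) (m : ℕ) :
    b * ∑ i ∈ Finset.range m, mu i =
      a * ∑ i ∈ Finset.range m, lam i + inner ℝ (p m) (q m) - inner ℝ (p 0) (q 0) := by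
  induction m with
  | zero => simp
  | succ m ih =>
    rw [Finset.sum_range_succ, Finset.sum_range_succ, mul_add, mul_add, ih]
    have h1 := h.level_p (m + 1)
    have h2 := h.level_q m
    rw [h.q_succ m, inner_add_right, inner_smul_right, real_inner_comm (v (m + 1)), h1, h.p_succ m,
      inner_sub_left, inner_smul_left, RCLike.conj_to_real, h2]
    ring

theorem w_eq_neg (hW : IsVertexSet W) (h : IsOrbit W V a b q p w v lam mu) {m : ℕ}
    (hq : q m = -q 0) : w m = -w 0 := by
  refine IsActive.unique hW (h.generic_q m) (h.active_q m) ?_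
  rw [hq]
  exact (h.active_q 0).neg hW

/-- The points `p 0` and `-p m` lie on one line of direction `w 0`, and at both of them `-w 0`
points into the body. A line has only one such entry point, so they coincide. -/
theorem eq_zero_of_antipodal (hW : IsVertexSet W) (hV : IsVertexSet V)
    (h : IsOrbit W V a b q p w v lam mu) {m : ℕ} {t : ℝ} (hq : q m = -q 0)
    (hp : p m = -(p 0 + t • w 0)) : t = 0 := by
  have hw := h.w_eq_neg hW hq
  have h1 := (h.active_p m).2 _ (hV.neg_mem _ (h.active_p 0).1)
  have h2 := (h.active_p 0).2 _ (hV.neg_mem _ (h.active_p m).1)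
  have h3 := h.level_p m
  have h4 := h.pos m
  have h5 := h.pos 0
  rw [h.level_p] at h1 h2
  rw [hp] at h1 h3
  rw [hw] at h4
  simp only [inner_neg_left, inner_neg_right, inner_add_right, inner_smul_right, h.level_p] at *
  apply le_antisymm
  · nlinarith
  · nlinarith

end IsOrbit

/-- Every orbit reaches the antipode of its starting point after `n` bounces, having run half of
its length. -/
def HasAntipodalOrbits (W V : Set (EuclideanSpace ℝ (Fin n))) : Prop :=
  ∀ a b q p w v lam mu, IsOrbit W V a b q p w v lam mu →
    q n = -q 0 ∧ p n = -p 0 ∧ ∑ i ∈ Finset.range n, lam i = 2 * b ∧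
      ∑ i ∈ Finset.range n, mu i = 2 * a

/-- The flipped orbit starts at `p 1`, so it yields the antipodes of `q 0` and `p 1` but not that of
`p 0`. Going one step back along `w n = -w 0` gives the latter up to a slide along `w 0`, which
`eq_zero_of_antipodal` excludes. The remaining sum comes from `sum_action`, whose boundary terms
cancel. -/
theorem HasAntipodalOrbits.symm {W V : Set (EuclideanSpace ℝ (Fin n))} (hW : IsVertexSet W)
    (hV : IsVertexSet V) (hVW : HasAntipodalOrbits V W) : HasAntipodalOrbits W V := by
  intro a b q p w v lam mu h
  obtain ⟨h1, h2, h3, -⟩ := hVW _ _ _ _ _ _ _ _ (h.flip hW)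
  simp only [neg_neg, zero_add] at h1 h2
  have hq : q n = -q 0 := by rw [← h2, neg_neg]
  have hp : p n = -(p 0 + (lam n - lam 0) • w 0) := by
    have e1 := h.p_succ n
    have e2 : p 1 = _ := h.p_succ 0
    rw [h1, e2, h.w_eq_neg hW hq] at e1
    rw [sub_smul]
    have : p n = -(p 0 - lam 0 • w 0) + lam n • -w 0 := by rw [e1]; abel
    rw [this, smul_neg]
    abel
  have ht := h.eq_zero_of_antipodal hW hV hq hp
  rw [ht, zero_smul, add_zero] at hp
  refine ⟨hq, hp, ?_, h3⟩
  have := h.sum_action n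
  rw [h3, hq, hp, inner_neg_neg] at this
  have ha := h.level_q_pos hW
  apply mul_left_cancel₀ ha.ne'
  linarith

end

/-! ### Orbits of the factors, and points of sums -/

noncomputable section

variable {n k l : ℕ}

/-- The orbit of one factor of a sum, starting between two bounces: the momentum runs from time
`0` on, and reaches `y j` at the time `tau j`, while the coordinate is `x j`. -/
structure IsPhaseOrbit (W V : Set (EuclideanSpace ℝ (Fin n))) (a b : ℝ)
    (x y w v : ℕ → EuclideanSpace ℝ (Fin n)) (mu tau : ℕ → ℝ) : Prop where
  generic_x : ∀ i, IsGeneric (x i)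
  generic_y : ∀ i, IsGeneric (y i)
  active_x : ∀ i, IsActive W (x i) (w i)
  active_y : ∀ i, IsActive V (y i) (v i)
  level_x : ∀ i, inner ℝ (w i) (x i) = a
  level_y : ∀ i, inner ℝ (v i) (y i) = b
  tau_lt : ∀ i, tau i < tau (i + 1)
  x_succ : ∀ i, x (i + 1) = x i + mu i • v i
  y_succ : ∀ i, y (i + 1) = y i - (tau (i + 1) - tau i) • w (i + 1)
  neg : ∀ i, inner ℝ (v i) (w i) < (0 : ℝ)
  pos : ∀ i, 0 < (inner ℝ (v i) (w (i + 1)) : ℝ)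
  x_antipodal : x n = -x 0
  y_antipodal : y n = -y 0
  w_antipodal : w n = -w 0
  tau_antipodal : tau n = tau 0 + 2 * b
  tau_le : ∀ i < n, tau i ≤ 2 * b

/-- Seen from the momentum, a phase orbit is an orbit of the exchanged pair with coordinate `y` and
momentum `-x`; its flight times, added to the phase `t` of the first hit, give `tau`. -/
theorem exists_isPhaseOrbit (hn : 0 < n) {W V : Set (EuclideanSpace ℝ (Fin n))}
    (hW : IsVertexSet W) (hV : IsVertexSet V) (hVW : HasAntipodalOrbits V W)
    {x₀ y₀ w₀ v₀ : EuclideanSpace ℝ (Fin n)} {t : ℝ} (hx : IsGeneric x₀) (hy : IsGeneric y₀)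
    (hw : IsActive W x₀ w₀) (hv : IsActive V y₀ v₀) (hneg : inner ℝ v₀ w₀ < (0 : ℝ))
    (hin : ∀ u ∈ V, inner ℝ u (y₀ + t • w₀) ≤ (inner ℝ v₀ y₀ : ℝ)) :
    ∃ x y w v mu tau, IsPhaseOrbit W V (inner ℝ w₀ x₀) (inner ℝ v₀ y₀) x y w v mu tau ∧
      x 0 = x₀ ∧ y 0 = y₀ ∧ w 0 = w₀ ∧ tau 0 = t := by
  obtain ⟨q, p, w, v, lam, mu, h, hq0, hp0, hw0, hv0⟩ := exists_isOrbit hV hW hy hx.neg hv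
    (hw.neg hW) (by rw [inner_neg_left, real_inner_comm]; linarith)
  rw [inner_neg_neg] at h
  obtain ⟨h1, h2, -, h4⟩ := hVW _ _ _ _ _ _ _ _ h
  have hvn : v n = -v 0 := by
    refine IsActive.unique hW (h.generic_p n) (h.active_p n) ?_
    rw [h2]
    exact (h.active_p 0).neg hW
  have hq := h.q_succ
  have hpos : ∀ i, 0 < (inner ℝ (w i) (-v (i + 1)) : ℝ) := fun i => by
    have := h.neg i
    rw [inner_neg_right, real_inner_comm]
    linarith
  have hlevel := h.level_q
  set b : ℝ := inner ℝ v₀ y₀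
  set tau : ℕ → ℝ := fun i => t + ∑ j ∈ Finset.range i, mu j with htau
  have htau_succ : ∀ i, tau (i + 1) = tau i + mu i := fun i => by
    simp only [htau, Finset.sum_range_succ]
    ring
  have htau_lt : ∀ i, tau i < tau (i + 1) := fun i => by
    rw [htau_succ]
    linarith [h.mu_pos i]
  have htau_n : tau n = tau 0 + 2 * b := by simp [htau, h4]
  have htau_zero : tau 0 = t := by simp [htau]
  refine ⟨fun i => -p i, q, fun i => -v i, w, lam, tau, ?_, by simp [hp0], hq0, by simp [hv0],
    htau_zero⟩
  exact
    { generic_x := fun i => (h.generic_p i).neg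
      generic_y := h.generic_q
      active_x := fun i => (h.active_p i).neg hW
      active_y := h.active_q
      level_x := fun i => by rw [inner_neg_neg]; exact h.level_p i
      level_y := h.level_q
      tau_lt := htau_lt
      x_succ := fun i => by rw [h.p_succ i]; abel
      y_succ := fun i => by
        rw [hq, htau_succ, add_sub_cancel_left, smul_neg, sub_neg_eq_add]
      neg := fun i => by
        have := h.pos i
        rw [inner_neg_right, real_inner_comm]
        linarith
      pos := hpos
      x_antipodal := by rw [h2]
      y_antipodal := h1
      w_antipodal := by rw [hvn]
      tau_antipodal := htau_n
      tau_le := by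
        obtain ⟨m, rfl⟩ : ∃ m, n = m + 1 := ⟨n - 1, by omega⟩
        -- Antipodality gives `-q m = y₀ + mu m • w₀`, the point where the backward ray from `y₀`
        -- leaves the body. Since `y₀ + t • w₀` is still inside, `t ≤ mu m`, and `tau m = t + 2 * b
        -- - mu m`.
        have hm : tau m ≤ 2 * b := by
          have e1 := hq m
          rw [h1, hq0] at e1
          have e2 := hin _ (hV.neg_mem _ (h.active_q m).1)
          have e3 := hlevel m
          have e4 := hpos m
          have e5 := htau_succ m
          have e6 : q m = -y₀ - mu m • v (m + 1) := by rw [e1]; abel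
          have e7 : -v (m + 1) = -w₀ := by rw [hvn, hv0, neg_neg]
          rw [neg_inj.1 e7] at e6
          rw [e7] at e4
          rw [e6] at e3
          simp only [inner_neg_left, inner_neg_right, inner_add_right, inner_sub_right,
            inner_smul_right] at e2 e3 e4
          nlinarith
        intro i hi
        exact (strictMono_nat_of_lt_succ htau_lt).monotone (Nat.lt_succ_iff.1 hi) |>.trans hm }

namespace IsPhaseOrbit

variable {W V : Set (EuclideanSpace ℝ (Fin n))} {a b : ℝ}
  {x y w v : ℕ → EuclideanSpace ℝ (Fin n)} {mu tau : ℕ → ℝ}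

/-- The vector `y j + (tau j - s) • w j` is the momentum at time `s` on the leg ending at `y j`.
After `tau j` it has crossed the facet `v j`, so staying in the body bounds `s`; the next two lemmas
are the strict and the boundary versions. -/
theorem le_tau (h : IsPhaseOrbit W V a b x y w v mu tau) {j : ℕ} {s : ℝ}
    (hs : ∀ u ∈ V, inner ℝ u (y j + (tau j - s) • w j) ≤ b) : s ≤ tau j := by
  have h1 := hs _ (h.active_y j).1
  have h2 := h.neg j
  rw [inner_add_right, inner_smul_right, h.level_y] at h1
  nlinarith

theorem lt_tau (h : IsPhaseOrbit W V a b x y w v mu tau) {j : ℕ} {s : ℝ}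
    (hs : ∀ u ∈ V, inner ℝ u (y j + (tau j - s) • w j) < b) : s < tau j := by
  have h1 := hs _ (h.active_y j).1
  have h2 := h.neg j
  rw [inner_add_right, inner_smul_right, h.level_y] at h1
  nlinarith

theorem eq_tau (h : IsPhaseOrbit W V a b x y w v mu tau) {j : ℕ} {s : ℝ}
    (hs : ∀ u ∈ V, inner ℝ u (y j + (tau j - s) • w j) ≤ b) {u : EuclideanSpace ℝ (Fin n)}
    (hu : u ∈ V) (hub : inner ℝ u (y j + (tau j - s) • w j) = b)
    (huw : inner ℝ u (w j) < (0 : ℝ)) : s = tau j := by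
  refine le_antisymm (h.le_tau hs) ?_
  have h1 := (h.active_y j).2 u hu
  rw [inner_add_right, inner_smul_right] at hub
  rw [h.level_y] at h1
  nlinarith

theorem eq_v (hV : IsVertexSet V) (h : IsPhaseOrbit W V a b x y w v mu tau) {j : ℕ}
    {u : EuclideanSpace ℝ (Fin n)} (hu : u ∈ V) (hub : inner ℝ u (y j) = b) : u = v j :=
  (h.generic_y j).eq_of_inner_eq (hV.integral u hu) (hV.integral _ (h.active_y j).1)
    (hub.trans (h.level_y j).symm)

/-- Both parameters mark the exit of the same ray from the body of level `a`. -/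
theorem eq_mu (h : IsPhaseOrbit W V a b x y w v mu tau) {j : ℕ} {t : ℝ}
    {u : EuclideanSpace ℝ (Fin n)} (hu : IsActive W (x j + t • v j) u)
    (hua : inner ℝ u (x j + t • v j) = a) (huv : 0 < (inner ℝ (v j) u : ℝ)) : t = mu j := by
  have h1 := hu.2 _ (h.active_x (j + 1)).1
  have h2 := (h.active_x (j + 1)).2 _ hu.1
  have h3 := h.level_x (j + 1)
  have h4 := h.pos j
  rw [real_inner_comm] at h4 huv
  rw [hua] at h1
  rw [h3] at h2
  rw [h.x_succ] at h2 h3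
  rw [inner_add_right, inner_smul_right] at *
  apply le_antisymm <;> nlinarith

theorem y_add_eq (h : IsPhaseOrbit W V a b x y w v mu tau) (j : ℕ) :
    y (j + 1) + (tau (j + 1) - tau j) • w (j + 1) = y j := by
  rw [h.y_succ]
  abel

theorem strictMono_tau (h : IsPhaseOrbit W V a b x y w v mu tau) : StrictMono tau :=
  strictMono_nat_of_lt_succ h.tau_lt

end IsPhaseOrbit

/-- The point of `ℝ^(k + l)` with given parts. -/
def glue (x : EuclideanSpace ℝ (Fin k)) (y : EuclideanSpace ℝ (Fin l)) :
    EuclideanSpace ℝ (Fin (k + l)) :=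
  WithLp.toLp 2 (Fin.append x y)

@[simp] theorem firstPart_glue (x : EuclideanSpace ℝ (Fin k)) (y : EuclideanSpace ℝ (Fin l)) :
    firstPart (glue x y) = x := by
  ext i
  simp [firstPart, glue]

@[simp] theorem lastPart_glue (x : EuclideanSpace ℝ (Fin k)) (y : EuclideanSpace ℝ (Fin l)) :
    lastPart (glue x y) = y := by
  ext i
  simp [lastPart, glue]

@[simp] theorem glue_parts (z : EuclideanSpace ℝ (Fin (k + l))) :
    glue (firstPart z) (lastPart z) = z := by
  ext i
  refine Fin.addCases (fun i => ?_) (fun i => ?_) i <;> simp [firstPart, lastPart, glue]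

theorem glue_inj {x x' : EuclideanSpace ℝ (Fin k)} {y y' : EuclideanSpace ℝ (Fin l)} :
    glue x y = glue x' y' ↔ x = x' ∧ y = y' := by
  constructor
  · intro h
    exact ⟨by simpa using congrArg firstPart h, by simpa using congrArg lastPart h⟩
  · rintro ⟨rfl, rfl⟩
    rfl

theorem inner_glue_left (x : EuclideanSpace ℝ (Fin k)) (y : EuclideanSpace ℝ (Fin l))
    (z : EuclideanSpace ℝ (Fin (k + l))) :
    (inner ℝ (glue x y) z : ℝ) = inner ℝ x (firstPart z) + inner ℝ y (lastPart z) := by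
  simp [PiLp.inner_apply, glue, firstPart, lastPart, Fin.sum_univ_add]

theorem inner_glue (x x' : EuclideanSpace ℝ (Fin k)) (y y' : EuclideanSpace ℝ (Fin l)) :
    (inner ℝ (glue x y) (glue x' y') : ℝ) = inner ℝ x x' + inner ℝ y y' := by
  rw [inner_glue_left, firstPart_glue, lastPart_glue]

theorem glue_add (x x' : EuclideanSpace ℝ (Fin k)) (y y' : EuclideanSpace ℝ (Fin l)) :
    glue x y + glue x' y' = glue (x + x') (y + y') := by
  ext i
  refine Fin.addCases (fun i => ?_) (fun i => ?_) i <;> simp [glue]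

theorem glue_smul (c : ℝ) (x : EuclideanSpace ℝ (Fin k)) (y : EuclideanSpace ℝ (Fin l)) :
    c • glue x y = glue (c • x) (c • y) := by
  ext i
  refine Fin.addCases (fun i => ?_) (fun i => ?_) i <;> simp [glue]

theorem glue_neg (x : EuclideanSpace ℝ (Fin k)) (y : EuclideanSpace ℝ (Fin l)) :
    -glue x y = glue (-x) (-y) := by
  ext i
  refine Fin.addCases (fun i => ?_) (fun i => ?_) i <;> simp [glue]

@[simp] theorem glue_zero : glue (0 : EuclideanSpace ℝ (Fin k)) (0 :
    EuclideanSpace ℝ (Fin l)) = 0 := by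
  ext i
  refine Fin.addCases (fun i => ?_) (fun i => ?_) i <;> simp [glue]

theorem glue_mem_intLattice {x : EuclideanSpace ℝ (Fin k)} {y : EuclideanSpace ℝ (Fin l)}
    (hx : x ∈ intLattice k) (hy : y ∈ intLattice l) : glue x y ∈ intLattice (k + l) := by
  intro i
  refine Fin.addCases (fun i => ?_) (fun i => ?_) i
  · simpa [glue] using mem_intLattice.1 hx i
  · simpa [glue] using mem_intLattice.1 hy i

theorem IsGeneric.left {x : EuclideanSpace ℝ (Fin k)} {y : EuclideanSpace ℝ (Fin l)}
    (h : IsGeneric (glue x y)) : IsGeneric x := fun c hc h0 =>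
  (glue_inj.1 ((h (glue c 0) (glue_mem_intLattice hc (zero_mem _))
    (by rw [inner_glue, h0, inner_zero_left, add_zero])).trans glue_zero.symm)).1

theorem IsGeneric.right {x : EuclideanSpace ℝ (Fin k)} {y : EuclideanSpace ℝ (Fin l)}
    (h : IsGeneric (glue x y)) : IsGeneric y := fun c hc h0 =>
  (glue_inj.1 ((h (glue 0 c) (glue_mem_intLattice (zero_mem _) hc)
    (by rw [inner_glue, h0, inner_zero_left, add_zero])).trans glue_zero.symm)).2

/-! ### Normals of sums of bodies -/

/-- The vertices of the product of two polytopes. -/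
def prodVertices (W : Set (EuclideanSpace ℝ (Fin k))) (W' : Set (EuclideanSpace ℝ (Fin l))) :
    Set (EuclideanSpace ℝ (Fin (k + l))) :=
  image2 glue W W'

/-- The vertices of the free sum of two polytopes. -/
def sumVertices (V : Set (EuclideanSpace ℝ (Fin k))) (V' : Set (EuclideanSpace ℝ (Fin l))) :
    Set (EuclideanSpace ℝ (Fin (k + l))) :=
  (fun v => glue v 0) '' V ∪ (fun v => glue 0 v) '' V'

variable {W V : Set (EuclideanSpace ℝ (Fin k))} {W' V' : Set (EuclideanSpace ℝ (Fin l))}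

theorem forall_mem_prodVertices {P : EuclideanSpace ℝ (Fin (k + l)) → Prop} :
    (∀ w ∈ prodVertices W W', P w) ↔ ∀ w ∈ W, ∀ w' ∈ W', P (glue w w') :=
  forall_mem_image2

theorem forall_mem_sumVertices {P : EuclideanSpace ℝ (Fin (k + l)) → Prop} :
    (∀ v ∈ sumVertices V V', P v) ↔ (∀ v ∈ V, P (glue v 0)) ∧ ∀ v ∈ V', P (glue 0 v) := by
  simp [sumVertices, or_imp, forall_and]

theorem IsVertexSet.prod (hW : IsVertexSet W) (hW' : IsVertexSet W') :
    IsVertexSet (prodVertices W W') where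
  finite := hW.finite.image2 _ hW'.finite
  nonempty := hW.nonempty.image2 hW'.nonempty
  neg_mem := forall_mem_prodVertices.2 fun w hw w' hw' => by
    rw [glue_neg]
    exact mem_image2_of_mem (hW.neg_mem w hw) (hW'.neg_mem w' hw')
  integral := forall_mem_prodVertices.2 fun w hw w' hw' =>
    glue_mem_intLattice (hW.integral w hw) (hW'.integral w' hw')
  ne_zero := forall_mem_prodVertices.2 fun w hw w' _ h =>
    hW.ne_zero w hw (glue_inj.1 (h.trans glue_zero.symm)).1

theorem IsVertexSet.sum (hV : IsVertexSet V) (hV' : IsVertexSet V') :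
    IsVertexSet (sumVertices V V') where
  finite := (hV.finite.image _).union (hV'.finite.image _)
  nonempty := (hV.nonempty.image _).mono subset_union_left
  neg_mem := forall_mem_sumVertices.2
    ⟨fun v hv => Or.inl ⟨-v, hV.neg_mem v hv, by simp [glue_neg]⟩,
      fun v hv => Or.inr ⟨-v, hV'.neg_mem v hv, by simp [glue_neg]⟩⟩
  integral := forall_mem_sumVertices.2
    ⟨fun v hv => glue_mem_intLattice (hV.integral v hv) (zero_mem _),
      fun v hv => glue_mem_intLattice (zero_mem _) (hV'.integral v hv)⟩
  ne_zero := forall_mem_sumVertices.2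
    ⟨fun v hv h => hV.ne_zero v hv (glue_inj.1 (h.trans glue_zero.symm)).1,
      fun v hv h => hV'.ne_zero v hv (glue_inj.1 (h.trans glue_zero.symm)).2⟩

theorem IsPolarPair.oneSum (h : IsPolarPair W V) (h' : IsPolarPair W' V') :
    IsPolarPair (prodVertices W W') (sumVertices V V') where
  left := h.left.prod h'.left
  right := h.right.sum h'.right
  inner_le_one := forall_mem_prodVertices.2 fun w hw w' hw' => forall_mem_sumVertices.2
    ⟨fun v hv => by simpa [inner_glue] using h.inner_le_one w hw v hv,
      fun v hv => by simpa [inner_glue] using h'.inner_le_one w' hw' v hv⟩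
  inner_le_mul := fun q p a b hq hp => by
    rw [forall_mem_prodVertices] at hq
    rw [forall_mem_sumVertices] at hp
    simp only [inner_glue_left, inner_zero_left, add_zero, zero_add] at hq hp
    obtain ⟨w, hw⟩ := h.left.exists_isActive (firstPart q)
    obtain ⟨w', hw'⟩ := h'.left.exists_isActive (lastPart q)
    obtain ⟨v, hv⟩ := h.right.exists_isActive (firstPart p)
    -- The factor inequalities share the bound `b`, so their sum is `b` times a sum of two maxima;
    -- nonnegativity of `b`, from the symmetry of `V`, lets that sum be replaced by `a`.
    have hb : 0 ≤ b := (hv.nonneg h.right).trans (hp.1 v hv.1)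
    have h1 := h.inner_le_mul _ _ _ _ hw.2 hp.1
    have h2 := h'.inner_le_mul _ _ _ _ hw'.2 hp.2
    have h3 := mul_le_mul_of_nonneg_right (hq w hw.1 w' hw'.1) hb
    have h4 : (inner ℝ p q : ℝ) =
        inner ℝ (firstPart p) (firstPart q) + inner ℝ (lastPart p) (lastPart q) := by
      rw [← inner_glue, glue_parts, glue_parts]
    linarith

theorem isActive_prodVertices {x w : EuclideanSpace ℝ (Fin k)} {x' w' : EuclideanSpace ℝ (Fin l)} :
    IsActive (prodVertices W W') (glue x x') (glue w w') ↔ IsActive W x w ∧ IsActive W' x' w' := by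
  constructor
  · rintro ⟨h1, h2⟩
    obtain ⟨u, hu, u', hu', h⟩ := h1
    obtain ⟨rfl, rfl⟩ := glue_inj.1 h
    rw [forall_mem_prodVertices] at h2
    simp only [inner_glue] at h2
    exact ⟨⟨hu, fun z hz => by simpa using h2 z hz u' hu'⟩,
      ⟨hu', fun z hz => by simpa using h2 u hu z hz⟩⟩
  · rintro ⟨h1, h2⟩
    refine ⟨mem_image2_of_mem h1.1 h2.1, forall_mem_prodVertices.2 fun z hz z' hz' => ?_⟩
    rw [inner_glue, inner_glue]
    exact add_le_add (h1.2 z hz) (h2.2 z' hz')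

theorem exists_glue (z : EuclideanSpace ℝ (Fin (k + l))) : ∃ x y, z = glue x y :=
  ⟨firstPart z, lastPart z, (glue_parts z).symm⟩

end

/-! ### Orbits of sums -/

noncomputable section

variable {n k l : ℕ}

/-- This is boundedness: every ray leaves the body. Otherwise symmetry makes all of `V` nonpositive
on `w`, and `inner_le_mul` with bound 0 gives `⟨w, w⟩ ≤ 0`. -/
theorem IsPolarPair.exists_inner_neg {W V : Set (EuclideanSpace ℝ (Fin n))} (h : IsPolarPair W V)
    {w : EuclideanSpace ℝ (Fin n)} (hw : w ≠ 0) : ∃ u ∈ V, inner ℝ u w < (0 : ℝ) := by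
  by_contra! hcon
  obtain ⟨z, hz⟩ := h.left.exists_isActive w
  have := h.inner_le_mul w w _ 0 hz.2 fun u hu => by
    have := hcon (-u) (h.right.neg_mem u hu)
    rw [inner_neg_left] at this
    linarith
  rw [mul_zero] at this
  exact hw (real_inner_self_nonpos.1 this)

/-- The start `p₀` may be interior to the body of level `b`, since in a sum the other part may be
the one on the boundary. Then `b` is not tied to the coordinates of `p₀`, so genericity at the exit
has to be supplied from the whole space as `hgen`. -/
theorem IsPolarPair.exists_isPhaseOrbit {W V : Set (EuclideanSpace ℝ (Fin n))}
    (h : IsPolarPair W V) (hn : 0 < n) (hWV : HasAntipodalOrbits W V)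
    {x₀ p₀ w₀ : EuclideanSpace ℝ (Fin n)} {b : ℝ} (hx : IsGeneric x₀) (hw : IsActive W x₀ w₀)
    (hp : ∀ u ∈ V, inner ℝ u p₀ ≤ b) (hp' : ∀ u ∈ V, inner ℝ u w₀ < (0 : ℝ) → inner ℝ u p₀ < b)
    (hgen : ∀ (t : ℝ), ∀ u ∈ V, inner ℝ u w₀ < (0 : ℝ) → inner ℝ u (p₀ - t • w₀) = b →
      IsGeneric (p₀ - t • w₀)) :
    ∃ x y w v mu tau, IsPhaseOrbit W V (inner ℝ w₀ x₀) b x y w v mu tau ∧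
      x 0 = x₀ ∧ p₀ = y 0 + tau 0 • w 0 ∧ w 0 = w₀ ∧ 0 < tau 0 := by
  obtain ⟨t, ht, v₀, hv₀, hneg, hlev, hle⟩ := exists_exit h.right.finite hp hp'
    (h.exists_inner_neg (h.left.ne_zero _ hw.1))
  obtain ⟨x, y, w, v, mu, tau, hph, h1, h2, h3, h4⟩ := Billiard.exists_isPhaseOrbit hn h.left
    h.right (hWV.symm h.right h.left) hx (hgen t v₀ hv₀ hneg hlev) hw
    (v₀ := v₀) ⟨hv₀, fun u hu => (hle u hu).trans_eq hlev.symm⟩ hneg (t := t)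
    (by rw [sub_add_cancel, hlev]; exact hp)
  rw [hlev] at hph
  exact ⟨x, y, w, v, mu, tau, hph, h1, by rw [h2, h3, h4]; abel, h3, by rwa [h4]⟩

variable {W V : Set (EuclideanSpace ℝ (Fin k))} {W' V' : Set (EuclideanSpace ℝ (Fin l))}

/-- An orbit of the sum is obtained by merging orbits of the factors in the order of the times of
their bounces. -/
theorem IsOrbit.exists_merge (hV : IsVertexSet V) (hV' : IsVertexSet V')
    (hW : IsVertexSet W) (hW' : IsVertexSet W') {a a₁ a₂ b : ℝ}
    {q p w v : ℕ → EuclideanSpace ℝ (Fin (k + l))} {lam mu : ℕ → ℝ}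
    (h : IsOrbit (prodVertices W W') (sumVertices V V') a b q p w v lam mu)
    {x y ω υ : ℕ → EuclideanSpace ℝ (Fin k)} {x' y' ω' υ' : ℕ → EuclideanSpace ℝ (Fin l)}
    {ν τ ν' τ' : ℕ → ℝ} (hK : IsPhaseOrbit W V a₁ b x y ω υ ν τ)
    (hL : IsPhaseOrbit W' V' a₂ b x' y' ω' υ' ν' τ') (hq : q 0 = glue (x 0) (x' 0))
    (hp : p 0 = glue (y 0 + τ 0 • ω 0) (y' 0 + τ' 0 • ω' 0)) (hτ : 0 < τ 0) (hτ' : 0 < τ' 0)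
    (i : ℕ) :
    ∃ c d s, s = ∑ j ∈ Finset.range i, lam j ∧ c + d = i ∧ q i = glue (x c) (x' d) ∧
      p i = glue (y c + (τ c - s) • ω c) (y' d + (τ' d - s) • ω' d) ∧
      s < τ c ∧ s < τ' d ∧ (∀ j < c, τ j ≤ s) ∧ ∀ j < d, τ' j ≤ s := by
  -- At time `s`, after `i` bounces, the factors have had `c` and `d` hits; all these hits happened
  -- by time `s`, and the next ones are strictly later.
  induction i with
  | zero => exact ⟨0, 0, 0, by simp, rfl, hq, by simpa using hp, hτ, hτ', by simp, by simp⟩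
  | succ i ih =>
    obtain ⟨c, d, s, hs, hcd, hqi, hpi, hsc, hsd, hc, hd⟩ := ih
    have hlam := h.lam_pos i
    obtain ⟨s', hs'⟩ : ∃ s', s' = s + lam i := ⟨_, rfl⟩
    have hsum : s' = ∑ j ∈ Finset.range (i + 1), lam j := by rw [Finset.sum_range_succ, hs', hs]
    have hwi : w i = glue (ω c) (ω' d) := by
      refine IsActive.unique (hW.prod hW') (h.generic_q i) (h.active_q i) ?_
      rw [hqi]
      exact isActive_prodVertices.2 ⟨hK.active_x c, hL.active_x d⟩
    have ha : a = a₁ + a₂ := by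
      rw [← h.level_q i, hwi, hqi, inner_glue, hK.level_x, hL.level_x]
    have hp1 : p (i + 1) = glue (y c + (τ c - s') • ω c) (y' d + (τ' d - s') • ω' d) := by
      rw [h.p_succ, hpi, hwi, sub_eq_add_neg, glue_smul, glue_neg, glue_add, hs']
      congr 1 <;> module
    have hle := (h.active_p (i + 1)).2
    rw [h.level_p, hp1, forall_mem_sumVertices] at hle
    simp only [inner_glue, inner_zero_left, add_zero, zero_add] at hle
    have hlev := h.level_p (i + 1)
    have hneg := h.neg i
    have hpos := h.pos (i + 1)
    have hact := h.active_q (i + 1)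
    have hlevq := h.level_q (i + 1)
    have hq1 := h.q_succ i
    obtain ⟨z, z', hz⟩ := exists_glue (w (i + 1))
    rw [hz] at hact hlevq hpos
    rw [hp1] at hlev
    rw [hwi] at hneg
    rw [hqi] at hq1
    have hgen := h.generic_p (i + 1)
    rw [hp1] at hgen
    have hv := (h.active_p (i + 1)).1
    -- The facet now hit belongs to one of the factors, and only that factor advances.
    rcases hv with ⟨u, hu, hv⟩ | ⟨u, hu, hv⟩
    · simp only at hv
      rw [← hv] at hq1 hlev hneg hpos
      rw [inner_glue, inner_zero_left, add_zero] at hlev hneg hpos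
      have hst := hK.eq_tau hle.1 hu hlev hneg
      have huv : u = υ c := by
        refine hK.eq_v hV hu ?_
        rwa [hst, sub_self, zero_smul, add_zero] at hlev
      -- A simultaneous hit of both factors would give two distinct integral normals with equal
      -- values at a generic momentum.
      have hlt : s' < τ' d := by
        refine hL.lt_tau fun u' hu' => lt_of_le_of_ne (hle.2 u' hu') fun h0 => ?_
        have := hgen.eq_of_inner_eq
          (glue_mem_intLattice (hV.integral u hu) (zero_mem _))
          (glue_mem_intLattice (zero_mem _) (hV'.integral u' hu'))
          (by rw [inner_glue, inner_glue, inner_zero_left, inner_zero_left, add_zero, zero_add,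
            hlev, h0])
        exact hV.ne_zero u hu (glue_inj.1 this).1
      rw [huv] at hq1 hpos
      rw [glue_smul, glue_add, smul_zero, add_zero] at hq1
      rw [hq1, isActive_prodVertices] at hact
      -- The second coordinate is unmoved, so its normal and its level `a₂` persist. The first part
      -- must then return to level `a₁`, which determines the flight time.
      have hz' : z' = ω' d :=
        IsActive.unique hW' (hL.generic_x d) hact.2 (hL.active_x d)
      have hmu : mu i = ν c := by
        refine hK.eq_mu hact.1 ?_ hpos
        rw [hq1, inner_glue, hz', hL.level_x, ha] at hlevq
        linarith
      refine ⟨c + 1, d, s', hsum, by omega, ?_, ?_, ?_, hlt, ?_, ?_⟩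
      · rw [hq1, hmu, hK.x_succ]
      · rw [hp1, hst, hK.y_add_eq, sub_self, zero_smul, add_zero]
      · rw [hst]
        exact hK.tau_lt c
      · intro j hj
        rw [hst]
        exact hK.strictMono_tau.monotone (Nat.lt_succ_iff.1 hj)
      · intro j hj
        have := hd j hj
        linarith
    · simp only at hv
      rw [← hv] at hq1 hlev hneg hpos
      rw [inner_glue, inner_zero_left, zero_add] at hlev hneg hpos
      have hst := hL.eq_tau hle.2 hu hlev hneg
      have huv : u = υ' d := by
        refine hL.eq_v hV' hu ?_
        rwa [hst, sub_self, zero_smul, add_zero] at hlev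
      have hlt : s' < τ c := by
        refine hK.lt_tau fun u' hu' => lt_of_le_of_ne (hle.1 u' hu') fun h0 => ?_
        have := hgen.eq_of_inner_eq
          (glue_mem_intLattice (zero_mem _) (hV'.integral u hu))
          (glue_mem_intLattice (hV.integral u' hu') (zero_mem _))
          (by rw [inner_glue, inner_glue, inner_zero_left, inner_zero_left, add_zero, zero_add,
            hlev, h0])
        exact hV'.ne_zero u hu (glue_inj.1 this).2
      rw [huv] at hq1 hpos
      rw [glue_smul, glue_add, smul_zero, add_zero] at hq1
      rw [hq1, isActive_prodVertices] at hact
      have hz' : z = ω c :=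
        IsActive.unique hW (hK.generic_x c) hact.1 (hK.active_x c)
      have hmu : mu i = ν' d := by
        refine hL.eq_mu hact.2 ?_ hpos
        rw [hq1, inner_glue, hz', hK.level_x, ha] at hlevq
        linarith
      refine ⟨c, d + 1, s', hsum, by omega, ?_, ?_, hlt, ?_, ?_, ?_⟩
      · rw [hq1, hmu, hL.x_succ]
      · rw [hp1, hst, hL.y_add_eq, sub_self, zero_smul, add_zero]
      · rw [hst]
        exact hL.tau_lt d
      · intro j hj
        have := hc j hj
        linarith
      · intro j hj
        rw [hst]
        exact hL.strictMono_tau.monotone (Nat.lt_succ_iff.1 hj)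

theorem HasAntipodalOrbits.oneSum (hk : 0 < k) (hl : 0 < l) (h : IsPolarPair W V)
    (h' : IsPolarPair W' V') (hA : HasAntipodalOrbits W V) (hA' : HasAntipodalOrbits W' V') :
    HasAntipodalOrbits (prodVertices W W') (sumVertices V V') := by
  intro a b q p w v lam mu ho
  have hWW := h.left.prod h'.left
  have hVV := h.right.sum h'.right
  obtain ⟨x₀, x₀', hq0⟩ := exists_glue (q 0)
  obtain ⟨p₀, p₀', hp0⟩ := exists_glue (p 0)
  obtain ⟨w₀, w₀', hw0⟩ := exists_glue (w 0)
  have hgq := ho.generic_q 0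
  have hgp := ho.generic_p 0
  have hact := ho.active_q 0
  rw [hq0] at hgq
  rw [hq0, hw0, isActive_prodVertices] at hact
  have hexit : ∀ u ∈ sumVertices V V', inner ℝ u (w 0) < (0 : ℝ) → inner ℝ u (p 0) < b := by
    intro u hu hneg
    refine lt_of_le_of_ne (((ho.active_p 0).2 u hu).trans_eq (ho.level_p 0)) fun h0 => ?_
    have := hgp.eq_of_inner_eq (hVV.integral u hu) (hVV.integral _ (ho.active_p 0).1)
      (h0.trans (ho.level_p 0).symm)
    have hpos := ho.pos 0
    rw [← this] at hpos
    linarith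
  -- Genericity at the first hit of a factor is proved for the whole momentum, where the level `b`
  -- is attained, and then restricted to the factor.
  have hgen : ∀ t : ℝ, ∀ u ∈ sumVertices V V', inner ℝ u (w 0) < (0 : ℝ) →
      inner ℝ u (p 0 - t • w 0) = b → IsGeneric (p 0 - t • w 0) := fun t u hu hneg hlev =>
    hgp.sub_smul (hVV.integral _ (ho.active_p 0).1) (hVV.integral u hu)
      (hWW.integral _ (ho.active_q 0).1) (ho.pos 0).ne' hneg.ne (hlev.trans (ho.level_p 0).symm)
  have hle := (ho.active_p 0).2
  have hsub : ∀ t : ℝ, p 0 - t • w 0 = glue (p₀ - t • w₀) (p₀' - t • w₀') := fun t => by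
    rw [hp0, hw0, sub_eq_add_neg, glue_smul, glue_neg, glue_add, ← sub_eq_add_neg, ← sub_eq_add_neg]
  simp only [hsub] at hgen
  rw [ho.level_p] at hle
  rw [hp0, forall_mem_sumVertices] at hle hexit
  rw [hw0] at hexit
  simp only [forall_mem_sumVertices, hw0] at hgen
  simp only [inner_glue, inner_zero_left, add_zero, zero_add] at hle hexit hgen
  obtain ⟨x, y, ω, υ, ν, τ, hK, hx, hy, hω, hτ⟩ := h.exists_isPhaseOrbit hk hA hgq.left hact.1
    hle.1 hexit.1 (fun t u hu h1 h2 => ((hgen t).1 u hu h1 h2).left)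
  obtain ⟨x', y', ω', υ', ν', τ', hL, hx', hy', hω', hτ'⟩ := h'.exists_isPhaseOrbit hl hA'
    hgq.right hact.2 hle.2 hexit.2 (fun t u hu h1 h2 => ((hgen t).2 u hu h1 h2).right)
  rw [← hx, ← hx'] at hq0
  rw [hy, hy'] at hp0
  rw [← hω, ← hω'] at hw0
  obtain ⟨c, d, s, hs, hcd, hq, hp, hsc, hsd, hc, hd⟩ :=
    ho.exists_merge h.right h'.right h.left h'.left hK hL hq0 hp0 hτ hτ' (k + l)
  -- More than `k` hits of the first factor take a time beyond `2 * b`, but they would leave `d <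
  -- l`, and the second factor makes its first `l` hits by time `2 * b`.
  have hck : c ≤ k := by
    by_contra! hlt
    have h1 := hc k hlt
    have h2 := hL.tau_le d (by omega)
    rw [hK.tau_antipodal] at h1
    linarith
  have hdl : d ≤ l := by
    by_contra! hlt
    have h1 := hd l hlt
    have h2 := hK.tau_le c (by omega)
    rw [hL.tau_antipodal] at h1
    linarith
  obtain rfl : c = k := by omega
  obtain rfl : d = l := by omega
  rw [hK.x_antipodal, hL.x_antipodal, ← glue_neg, ← hq0] at hq
  -- Only the clock `s` is still unknown: the momentum is antipodal up to the slide `2 * b - s`,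
  -- which must vanish.
  have hp1 : p (c + d) = -(p 0 + (2 * b - s) • w 0) := by
    rw [hp, hp0, hw0, hK.y_antipodal, hL.y_antipodal, hK.w_antipodal, hL.w_antipodal,
      hK.tau_antipodal, hL.tau_antipodal, glue_smul, glue_add, glue_neg]
    congr 1 <;> module
  have ht := ho.eq_zero_of_antipodal hWW hVV hq hp1
  rw [ht, zero_smul, add_zero] at hp1
  have hlam : ∑ j ∈ Finset.range (c + d), lam j = 2 * b := by
    rw [← hs]
    linarith
  refine ⟨hq, hp1, hlam, ?_⟩
  have := ho.sum_action (c + d)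
  rw [hq, hp1, inner_neg_neg, hlam] at this
  apply mul_left_cancel₀ (ho.level_p_pos hVV).ne'
  linarith

end

/-! ### Hanner polytopes and their trajectories -/

noncomputable section

variable {n k l : ℕ}

/-- The polytope with outer facet normals in `W`. -/
def vertexPolar (W : Set (EuclideanSpace ℝ (Fin n))) : Set (EuclideanSpace ℝ (Fin n)) :=
  {q | ∀ w ∈ W, inner ℝ w q ≤ (1 : ℝ)}

/-- The vertices of the segment `[-1, 1]`. -/
def segmentVertices : Set (EuclideanSpace ℝ (Fin 1)) :=
  {x | x 0 = 1 ∨ x 0 = -1}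

theorem inner_fin_one (x y : EuclideanSpace ℝ (Fin 1)) : (inner ℝ x y : ℝ) = y 0 * x 0 := by
  simp [PiLp.inner_apply]

theorem ext_fin_one {x y : EuclideanSpace ℝ (Fin 1)} (h : x 0 = y 0) : x = y := by
  ext i
  rwa [Subsingleton.elim i 0]

theorem isVertexSet_segmentVertices : IsVertexSet segmentVertices where
  finite := by
    refine (Set.toFinite {(WithLp.toLp 2 fun _ => 1 : EuclideanSpace ℝ (Fin 1)),
      WithLp.toLp 2 fun _ => -1}).subset ?_
    rintro x (h | h)
    · exact Or.inl (ext_fin_one h)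
    · exact Or.inr (ext_fin_one h)
  nonempty := ⟨WithLp.toLp 2 fun _ => 1, Or.inl rfl⟩
  neg_mem := by
    rintro w (h | h)
    · exact Or.inr (by simp [h])
    · exact Or.inl (by simp [h])
  integral := by
    rintro w (h | h) i
    · exact ⟨1, by simpa [Subsingleton.elim i 0] using h⟩
    · exact ⟨-1, by simpa [Subsingleton.elim i 0] using h⟩
  ne_zero := by
    rintro w (h | h) rfl <;> norm_num at h

theorem isPolarPair_segmentVertices : IsPolarPair segmentVertices segmentVertices where
  left := isVertexSet_segmentVertices
  right := isVertexSet_segmentVertices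
  inner_le_one := by
    rintro w (h | h) v (h' | h') <;> rw [inner_fin_one, h, h'] <;> norm_num
  inner_le_mul := fun q p a b hq hp => by
    have q1 := hq (WithLp.toLp 2 fun _ => 1) (Or.inl rfl)
    have q2 := hq (WithLp.toLp 2 fun _ => -1) (Or.inr rfl)
    have p1 := hp (WithLp.toLp 2 fun _ => 1) (Or.inl rfl)
    have p2 := hp (WithLp.toLp 2 fun _ => -1) (Or.inr rfl)
    simp only [inner_fin_one] at *
    nlinarith

/-- The normals are signs, and the sign conditions force `v 0 = w 0`, `v 1 = -w 0`, `w 1 = v 1`: one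
bounce exchanges the ends. -/
theorem hasAntipodalOrbits_segmentVertices :
    HasAntipodalOrbits segmentVertices segmentVertices := by
  intro a b q p w v lam mu h
  have e1 := h.level_q 0
  have e2 := h.level_q 1
  have e3 := h.level_p 0
  have e4 := h.level_p 1
  have e5 := h.pos 0
  have e6 := h.neg 0
  have e7 := h.pos 1
  have e8 : p 1 = _ := h.p_succ 0
  have e9 : q 1 = _ := h.q_succ 0
  have f1 : p 1 0 = p 0 0 - lam 0 * w 0 0 := by rw [e8]; simp
  have f2 : q 1 0 = q 0 0 + mu 0 * v 1 0 := by rw [e9]; simp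
  simp only [inner_fin_one, zero_add] at *
  have g : q 1 0 = -q 0 0 ∧ p 1 0 = -p 0 0 ∧ lam 0 = 2 * b ∧ mu 0 = 2 * a := by
    rcases (h.active_q 0).1 with h1 | h1 <;> rcases (h.active_q 1).1 with h2 | h2 <;>
    rcases (h.active_p 0).1 with h3 | h3 <;> rcases (h.active_p 1).1 with h4 | h4 <;>
    simp only [h1, h2, h3, h4] at * <;> norm_num at * <;>
    refine ⟨?_, ?_, ?_, ?_⟩ <;> linarith
  exact ⟨ext_fin_one (by simpa using g.1), ext_fin_one (by simpa using g.2.1), by simpa using g.2.2⟩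

theorem gauge_vertexPolar {W : Set (EuclideanSpace ℝ (Fin n))} (hW : IsVertexSet W)
    {q w : EuclideanSpace ℝ (Fin n)} (h : IsActive W q w) :
    gauge (vertexPolar W) q = inner ℝ w q := by
  have hset : {r ∈ Ioi (0 : ℝ) | r⁻¹ • q ∈ vertexPolar W} =
      {r : ℝ | 0 < r ∧ inner ℝ w q ≤ r} := by
    ext r
    refine and_congr_right fun hr => ?_
    have hr' : (0 : ℝ) < r := hr
    simp only [vertexPolar, mem_ofPred_eq, inner_smul_right]
    constructor
    · intro h'
      have := h' w h.1
      rwa [inv_mul_le_iff₀ hr', mul_one] at this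
    · intro h' u hu
      rw [inv_mul_le_iff₀ hr', mul_one]
      exact (h.2 u hu).trans h'
  have h0 := h.nonneg hW
  rw [gauge_def', hset]
  apply le_antisymm
  -- The slack `ε` is needed when `⟨w, q⟩ = 0`, a value that the set of positive `r` omits.
  · refine le_of_forall_pos_le_add fun ε hε => csInf_le ⟨0, fun r hr => hr.1.le⟩ ⟨?_, ?_⟩ <;> linarith
  · exact le_csInf ⟨inner ℝ w q + 1, by linarith, by linarith⟩ fun r hr => hr.2

variable {W : Set (EuclideanSpace ℝ (Fin k))} {W' : Set (EuclideanSpace ℝ (Fin l))}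

theorem oneSum_vertexPolar (hW : IsVertexSet W) (hW' : IsVertexSet W') :
    oneSum (vertexPolar W) (vertexPolar W') = vertexPolar (prodVertices W W') := by
  ext q
  obtain ⟨w, hw⟩ := hW.exists_isActive (firstPart q)
  obtain ⟨w', hw'⟩ := hW'.exists_isActive (lastPart q)
  simp only [oneSum, vertexPolar, mem_ofPred_eq, forall_mem_prodVertices, inner_glue_left]
  have h1 := gauge_vertexPolar hW hw
  have h2 := gauge_vertexPolar hW' hw'
  simp only [vertexPolar] at h1 h2
  rw [h1, h2]
  exact ⟨fun h u hu u' hu' => (add_le_add (hw.2 u hu) (hw'.2 u' hu')).trans h,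
    fun h => h w hw.1 w' hw'.1⟩

theorem infSum_vertexPolar (hW : IsVertexSet W) (hW' : IsVertexSet W') :
    infSum (vertexPolar W) (vertexPolar W') = vertexPolar (sumVertices W W') := by
  ext q
  obtain ⟨w, hw⟩ := hW.exists_isActive (firstPart q)
  obtain ⟨w', hw'⟩ := hW'.exists_isActive (lastPart q)
  simp only [infSum, vertexPolar, mem_ofPred_eq, forall_mem_sumVertices, inner_glue_left,
    inner_zero_left, add_zero, zero_add, max_le_iff]
  have h1 := gauge_vertexPolar hW hw
  have h2 := gauge_vertexPolar hW' hw'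
  simp only [vertexPolar] at h1 h2
  rw [h1, h2]
  exact ⟨fun h => ⟨fun u hu => (hw.2 u hu).trans h.1, fun u hu => (hw'.2 u hu).trans h.2⟩,
    fun h => ⟨h.1 w hw.1, h.2 w' hw'.1⟩⟩

theorem IsHannerPolytope.exists_vertices {H : Set (EuclideanSpace ℝ (Fin n))}
    (hH : IsHannerPolytope n H) : 0 < n ∧ ∃ W V, IsPolarPair W V ∧ HasAntipodalOrbits W V ∧
      H = vertexPolar W := by
  induction hH with
  | segment =>
    refine ⟨one_pos, segmentVertices, segmentVertices, isPolarPair_segmentVertices,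
      hasAntipodalOrbits_segmentVertices, ?_⟩
    ext q
    simp only [vertexPolar, mem_ofPred_eq, inner_fin_one]
    constructor
    · rintro h w (hw | hw) <;> rw [hw] <;> linarith
    · intro h
      have q1 := h (WithLp.toLp 2 fun _ => 1) (Or.inl rfl)
      have q2 := h (WithLp.toLp 2 fun _ => -1) (Or.inr rfl)
      simp only at q1 q2
      constructor <;> linarith
  | oneSum _ _ ih ih' =>
    obtain ⟨hk, W, V, h, hA, rfl⟩ := ih
    obtain ⟨hl, W', V', h', hA', rfl⟩ := ih'
    exact ⟨by omega, _, _, h.oneSum h', hA.oneSum hk hl h h' hA', oneSum_vertexPolar h.left h'.left⟩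
  | infSum _ _ ih ih' =>
    obtain ⟨hk, W, V, h, hA, rfl⟩ := ih
    obtain ⟨hl, W', V', h', hA', rfl⟩ := ih'
    -- The polar of an `⊕_∞`-sum is the `⊕₁`-sum of the polars, so this case is the previous one
    -- with coordinates and momenta exchanged.
    have hs := h.symm.oneSum h'.symm
    exact ⟨by omega, _, _, hs.symm, HasAntipodalOrbits.symm hs.right hs.left
      (HasAntipodalOrbits.oneSum hk hl h.symm h'.symm (hA.symm h.right h.left)
        (hA'.symm h'.right h'.left)), infSum_vertexPolar h.left h'.left⟩

/-! ### Norms, normals and boundaries in terms of active functionals -/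

section Geometry

variable {W V : Set (EuclideanSpace ℝ (Fin n))}

theorem IsPolarPair.polarBody_vertexPolar (h : IsPolarPair W V) :
    polarBody (vertexPolar W) = vertexPolar V := by
  ext p
  constructor
  · intro hp v hv
    rw [real_inner_comm]
    exact hp v fun w hw => h.inner_le_one w hw v hv
  · intro hp q hq
    simpa using h.inner_le_mul q p 1 1 hq hp

theorem isClosed_vertexPolar (W : Set (EuclideanSpace ℝ (Fin n))) : IsClosed (vertexPolar W) := by
  have : vertexPolar W = ⋂ w ∈ W, {q | inner ℝ w q ≤ (1 : ℝ)} := by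
    ext q
    simp [vertexPolar]
  rw [this]
  exact isClosed_biInter fun w _ => isClosed_le (by fun_prop) continuous_const

theorem inner_lt_one_of_mem_interior {q w : EuclideanSpace ℝ (Fin n)} (hw : w ∈ W) (hw0 : w ≠ 0)
    (hq : q ∈ interior (vertexPolar W)) : inner ℝ w q < (1 : ℝ) := by
  have hc : ContinuousAt (fun t : ℝ => q + t • w) 0 := by fun_prop
  have hev : ∀ᶠ t : ℝ in nhds 0, q + t • w ∈ vertexPolar W :=
    hc.eventually (by simpa using mem_interior_iff_mem_nhds.1 hq)
  obtain ⟨t, ht, htpos⟩ := ((hev.filter_mono nhdsWithin_le_nhds).and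
    (self_mem_nhdsWithin (a := (0 : ℝ)) (s := Ioi 0))).exists
  have h1 := ht w hw
  rw [inner_add_right, inner_smul_right] at h1
  have := mul_pos (mem_Ioi.1 htpos) (real_inner_self_pos.2 hw0)
  linarith

theorem mem_frontier_vertexPolar (hW : IsVertexSet W) {q : EuclideanSpace ℝ (Fin n)} :
    q ∈ frontier (vertexPolar W) ↔ (∀ u ∈ W, inner ℝ u q ≤ (1 : ℝ)) ∧
      ∃ w ∈ W, inner ℝ w q = (1 : ℝ) := by
  rw [(isClosed_vertexPolar W).frontier_eq]
  constructor
  · rintro ⟨h1, h2⟩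
    refine ⟨h1, ?_⟩
    by_contra! hcon
    refine h2 (mem_interior_iff_mem_nhds.2 ?_)
    have : ∀ᶠ x in nhds q, ∀ w ∈ W, inner ℝ w x < (1 : ℝ) :=
      (Filter.eventually_all_finite hW.finite).2 fun w hw =>
        (continuous_const.inner continuous_id).continuousAt.eventually_lt continuousAt_const
          (lt_of_le_of_ne (h1 w hw) (hcon w hw))
    filter_upwards [this] with x hx w hw using (hx w hw).le
  · rintro ⟨h1, w, hw, h2⟩
    exact ⟨h1, fun h => (inner_lt_one_of_mem_interior hw (hW.ne_zero w hw) h).ne h2⟩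

theorem IsActive.inner_eq_one (hW : IsVertexSet W) {q w : EuclideanSpace ℝ (Fin n)}
    (h : IsActive W q w) (hq : q ∈ frontier (vertexPolar W)) : inner ℝ w q = (1 : ℝ) := by
  obtain ⟨h1, u, hu, h2⟩ := (mem_frontier_vertexPolar hW).1 hq
  exact le_antisymm (h1 w h.1) (h2 ▸ h.2 u hu)

theorem IsPolarPair.bodyNorm_eq (h : IsPolarPair W V) {q w : EuclideanSpace ℝ (Fin n)}
    (hw : IsActive W q w) : bodyNorm (vertexPolar V) q = inner ℝ w q := by
  refine IsGreatest.csSup_eq ⟨⟨w, fun v hv => ?_, rfl⟩, ?_⟩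
  · rw [real_inner_comm]
    exact h.inner_le_one w hw.1 v hv
  · rintro _ ⟨p, hp, rfl⟩
    simpa using h.inner_le_mul q p _ 1 hw.2 hp

theorem IsPolarPair.inner_le_bodyNorm (h : IsPolarPair W V) {p q : EuclideanSpace ℝ (Fin n)}
    (hp : p ∈ vertexPolar V) : inner ℝ p q ≤ bodyNorm (vertexPolar V) q := by
  obtain ⟨w, hw⟩ := h.left.exists_isActive q
  rw [h.bodyNorm_eq hw]
  simpa using h.inner_le_mul q p _ 1 hw.2 hp

theorem IsPolarPair.bodyNorm_smul (h : IsPolarPair W V) {p v : EuclideanSpace ℝ (Fin n)} {t : ℝ}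
    (ht : 0 ≤ t) (hv : v ∈ V) (hp : p ∈ vertexPolar V) (hvp : inner ℝ v p = (1 : ℝ)) :
    bodyNorm (vertexPolar V) (t • v) = t := by
  apply le_antisymm
  · obtain ⟨w, hw⟩ := h.left.exists_isActive (t • v)
    rw [h.bodyNorm_eq hw, inner_smul_right]
    exact mul_le_of_le_one_right ht (h.inner_le_one w hw.1 v hv)
  · have := h.inner_le_bodyNorm hp (q := t • v)
    rwa [inner_smul_right, real_inner_comm, hvp, mul_one] at this

theorem IsActive.eventually (hW : IsVertexSet W) {q w : EuclideanSpace ℝ (Fin n)}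
    (hq : IsGeneric q) (h : IsActive W q w) : ∀ᶠ x in nhds q, IsActive W x w := by
  have : ∀ᶠ x in nhds q, ∀ u ∈ W, inner ℝ u x ≤ (inner ℝ w x : ℝ) := by
    refine (Filter.eventually_all_finite hW.finite).2 fun u hu => ?_
    rcases (h.2 u hu).eq_or_lt with h0 | h0
    · rw [hq.eq_of_inner_eq (hW.integral u hu) (hW.integral w h.1) h0]
      exact Filter.Eventually.of_forall fun _ => le_rfl
    · exact ((continuous_const.inner continuous_id).continuousAt.eventually_lt
        (continuous_const.inner continuous_id).continuousAt h0).mono fun x hx => hx.le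
  exact this.mono fun x hx => ⟨h.1, hx⟩

/-- The only active functional at a generic point stays active nearby, so the norm is locally
linear. -/
theorem IsPolarPair.hasGradientAt_bodyNorm (h : IsPolarPair W V) {q w : EuclideanSpace ℝ (Fin n)}
    (hq : IsGeneric q) (hw : IsActive W q w) :
    HasGradientAt (bodyNorm (vertexPolar V)) w q := by
  have h1 : HasGradientAt (fun x => (inner ℝ w x : ℝ)) w q := by
    rw [hasGradientAt_iff_hasFDerivAt]
    exact ((InnerProductSpace.toDual ℝ _) w).hasFDerivAt
  refine h1.congr_of_eventuallyEq ?_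
  filter_upwards [hw.eventually h.left hq] with x hx using h.bodyNorm_eq hx

theorem IsPolarPair.outerNormal_eq (h : IsPolarPair W V) {q w : EuclideanSpace ℝ (Fin n)}
    (hq : IsGeneric q) (hw : IsActive W q w) : outerNormal (vertexPolar W) q = w := by
  rw [outerNormal, h.polarBody_vertexPolar]
  exact (h.hasGradientAt_bodyNorm hq hw).gradient

theorem IsPolarPair.isSmoothBoundaryPoint (h : IsPolarPair W V) {q w : EuclideanSpace ℝ (Fin n)}
    (hq : IsGeneric q) (hw : IsActive W q w) (hwq : inner ℝ w q = (1 : ℝ)) :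
    IsSmoothBoundaryPoint (vertexPolar W) q := by
  refine ⟨(mem_frontier_vertexPolar h.left).2 ⟨fun u hu => hwq ▸ hw.2 u hu, w, hw.1, hwq⟩, ?_⟩
  rw [h.polarBody_vertexPolar]
  exact (h.hasGradientAt_bodyNorm hq hw).differentiableAt

/-! ### Orbits as classical trajectories: reflection, uniqueness, period, length, simplicity -/

namespace IsOrbit

variable {a b : ℝ} {q p w v : ℕ → EuclideanSpace ℝ (Fin n)} {lam mu : ℕ → ℝ}

theorem q_mem (h : IsOrbit W V 1 b q p w v lam mu) (i : ℕ) : q i ∈ vertexPolar W :=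
  fun u hu => ((h.active_q i).2 u hu).trans_eq (h.level_q i)

theorem p_mem (h : IsOrbit W V a 1 q p w v lam mu) (i : ℕ) : p i ∈ vertexPolar V :=
  fun u hu => ((h.active_p i).2 u hu).trans_eq (h.level_p i)

theorem bodyNorm_sub (hP : IsPolarPair W V) (h : IsOrbit W V a 1 q p w v lam mu) (i : ℕ) :
    bodyNorm (vertexPolar V) (q (i + 1) - q i) = mu i := by
  rw [h.q_succ, add_sub_cancel_left]
  exact hP.bodyNorm_smul (h.mu_pos i).le (h.active_p _).1 (h.p_mem (i + 1)) (h.level_p _)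

/-- Nearby boundary points `x` lie on the facet of `w (i + 1)`. Bounding the two norms below by the
momenta `p (i + 2)` and `p (i + 1)` gives an expression that depends on `x` only through their
difference, a multiple of `w (i + 1)`, and so is constant on that facet. At `q (i + 1)` both bounds
are equalities. -/
theorem hasBilliardReflection (hP : IsPolarPair W V) (h : IsOrbit W V 1 1 q p w v lam mu) (i : ℕ) :
    HasBilliardReflection (vertexPolar W) (vertexPolar V) (q i) (q (i + 1)) (q (i + 2)) := by
  refine ⟨h.q_mem _, (mem_frontier_vertexPolar hP.left).2 ⟨h.q_mem _, w (i + 1),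
    (h.active_q _).1, h.level_q _⟩, h.q_mem _, ?_⟩
  have hev := (h.active_q (i + 1)).eventually hP.left (h.generic_q (i + 1))
  filter_upwards [hev.filter_mono nhdsWithin_le_nhds, self_mem_nhdsWithin] with x hx hxf
  have h1 := hx.inner_eq_one hP.left hxf
  have h2 := hP.inner_le_bodyNorm (q := q (i + 2) - x) (h.p_mem (i + 2))
  have h3 := hP.inner_le_bodyNorm (q := x - q i) (h.p_mem (i + 1))
  have h4 : bodyNorm (vertexPolar V) (q (i + 2) - q (i + 1)) = mu (i + 1) :=
    h.bodyNorm_sub hP (i + 1)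
  rw [h4, h.bodyNorm_sub hP i]
  refine le_trans (le_of_eq ?_) (add_le_add h2 h3)
  have e1 : p (i + 2) = p (i + 1) - lam (i + 1) • w (i + 1) := h.p_succ (i + 1)
  have e2 : q (i + 2) = q (i + 1) + mu (i + 1) • v (i + 2) := h.q_succ (i + 1)
  have e3 := h.level_p (i + 1)
  have e4 := h.level_p (i + 2)
  have e5 := h.level_q (i + 1)
  have e6 := h.q_succ i
  have e7 : q (i + 2) - x = mu (i + 1) • v (i + 2) + (q (i + 1) - x) := by rw [e2]; abel
  have e8 : x - q i = mu i • v (i + 1) - (q (i + 1) - x) := by rw [e6]; abel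
  have e9 : (inner ℝ (w (i + 1)) (q (i + 1) - x) : ℝ) = 0 := by
    rw [inner_sub_right, e5, h1, sub_self]
  rw [e7, e8, inner_add_right, inner_sub_right (p (i + 1)), inner_smul_right, inner_smul_right,
    real_inner_comm (v (i + 2)), real_inner_comm (v (i + 1)), e3, e4, e1, inner_sub_left,
    inner_smul_left, e9]
  simp

theorem isClassicalTrajectory (hP : IsPolarPair W V) (h : IsOrbit W V 1 1 q p w v lam mu) :
    IsClassicalTrajectory (vertexPolar W) (vertexPolar V) q p where
  smooth_coordinate := fun i =>
    hP.isSmoothBoundaryPoint (h.generic_q i) (h.active_q i) (h.level_q i)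
  smooth_momentum := fun i =>
    hP.symm.isSmoothBoundaryPoint (h.generic_p i) (h.active_p i) (h.level_p i)
  momentum_change := fun i => ⟨lam i, h.lam_pos i, by
    rw [hP.outerNormal_eq (h.generic_q i) (h.active_q i), h.p_succ]
    abel⟩
  coordinate_change := fun i => ⟨mu i, h.mu_pos i, by
    rw [hP.symm.outerNormal_eq (h.generic_p _) (h.active_p _), h.q_succ]
    abel⟩
  reflection := h.hasBilliardReflection hP

/-- A ray entering a convex body meets its boundary once more. This is why membership in the
boundary alone determines a competing trajectory. -/
theorem lam_unique (hV : IsVertexSet V) (h : IsOrbit W V a b q p w v lam mu) {i : ℕ} {t : ℝ}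
    (ht : 0 < t) (hle : ∀ u ∈ V, inner ℝ u (p i - t • w i) ≤ b)
    (hex : ∃ u ∈ V, inner ℝ u (p i - t • w i) = b) : t = lam i := by
  have hp := h.p_succ i
  have hlev := h.level_p (i + 1)
  have hact := (h.active_p (i + 1)).2
  rw [hp] at hlev hact
  obtain ⟨u, hu, hub⟩ := hex
  refine le_antisymm (le_of_exit (h.neg i) hlev (hle _ (h.active_p _).1)) (le_of_exit ?_ hub
    ((hact u hu).trans_eq hlev))
  rw [inner_sub_right, inner_smul_right] at hub
  have h1 := (h.active_p i).2 u hu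
  rw [h.level_p] at h1
  -- A facet not approached by the ray would already be active at `p i`, hence be `v i` by
  -- genericity; but the ray moves strictly away from that facet.
  by_contra! h0
  have h2 : (inner ℝ u (p i) : ℝ) = b := by
    have := mul_nonneg ht.le h0
    linarith
  have h3 := (h.generic_p i).eq_of_inner_eq (hV.integral u hu) (hV.integral _ (h.active_p i).1)
    (h2.trans (h.level_p i).symm)
  have h4 := mul_pos ht (h.pos i)
  rw [← h3] at h4
  linarith

theorem mu_unique (hW : IsVertexSet W) (h : IsOrbit W V a b q p w v lam mu) {i : ℕ} {t : ℝ}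
    (ht : 0 < t) (hle : ∀ u ∈ W, inner ℝ u (q i + t • v (i + 1)) ≤ a)
    (hex : ∃ u ∈ W, inner ℝ u (q i + t • v (i + 1)) = a) : t = mu i := by
  have hneg : -q i - t • v (i + 1) = -(q i + t • v (i + 1)) := by abel
  refine (h.flip hW).lam_unique hW ht (fun u hu => ?_) ?_
  · simp only [hneg]
    rw [inner_neg_right, ← inner_neg_left]
    exact hle _ (hW.neg_mem u hu)
  · obtain ⟨u, hu, hub⟩ := hex
    refine ⟨-u, hW.neg_mem u hu, ?_⟩
    simp only [hneg]
    rwa [inner_neg_neg]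

theorem unique (hP : IsPolarPair W V) (h : IsOrbit W V 1 1 q p w v lam mu)
    {q' p' : ℕ → EuclideanSpace ℝ (Fin n)}
    (h' : IsClassicalTrajectory (vertexPolar W) (vertexPolar V) q' p') (hq : q' 0 = q 0)
    (hp : p' 0 = p 0) (i : ℕ) : q' i = q i ∧ p' i = p i := by
  induction i with
  | zero => exact ⟨hq, hp⟩
  | succ i ih =>
    have hpi : p' (i + 1) = p (i + 1) := by
      obtain ⟨t, ht, htp⟩ := h'.momentum_change i
      rw [ih.1, ih.2, hP.outerNormal_eq (h.generic_q i) (h.active_q i), sub_eq_iff_eq_add,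
        neg_add_eq_sub] at htp
      have hf := (mem_frontier_vertexPolar hP.right).1 (h'.smooth_momentum (i + 1)).1
      rw [htp] at hf
      rw [htp, h.p_succ, h.lam_unique hP.right ht hf.1 hf.2]
    refine ⟨?_, hpi⟩
    obtain ⟨t, ht, htq⟩ := h'.coordinate_change i
    rw [ih.1, hpi, hP.symm.outerNormal_eq (h.generic_p _) (h.active_p _), sub_eq_iff_eq_add,
      add_comm (t • _)] at htq
    have hf := (mem_frontier_vertexPolar hP.left).1 (h'.smooth_coordinate (i + 1)).1
    rw [htq] at hf
    rw [htq, h.q_succ, h.mu_unique hP.left ht hf.1 hf.2]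

theorem half_period (hA : HasAntipodalOrbits W V) (h : IsOrbit W V a b q p w v lam mu) (i : ℕ) :
    q (i + n) = -q i ∧ p (i + n) = -p i ∧ ∑ j ∈ Finset.range n, mu (i + j) = 2 * a := by
  obtain ⟨h1, h2, -, h3⟩ := hA _ _ _ _ _ _ _ _ (h.shift i)
  simp only [add_comm _ i] at h1 h2 h3
  exact ⟨h1, h2, h3⟩

theorem isClosedTrajectory (hn : 0 < n) (hA : HasAntipodalOrbits W V)
    (h : IsOrbit W V a b q p w v lam mu) : IsClosedTrajectory (2 * n) q p := by
  refine ⟨by omega, fun i => ?_⟩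
  have h1 := h.half_period hA i
  have h2 := h.half_period hA (i + n)
  rw [two_mul, ← add_assoc, h2.1, h2.2.1, h1.1, h1.2.1, neg_neg, neg_neg]
  exact ⟨rfl, rfl⟩

theorem closedLength_eq (hP : IsPolarPair W V) (hA : HasAntipodalOrbits W V)
    (h : IsOrbit W V 1 1 q p w v lam mu) : closedLength (vertexPolar V) (2 * n) q = 4 := by
  simp only [closedLength, h.bodyNorm_sub hP]
  have h1 := (h.half_period hA 0).2.2
  have h2 := (h.half_period hA n).2.2
  simp only [zero_add] at h1
  rw [two_mul, Finset.sum_range_add, h1, h2]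
  norm_num

/-- Along a flight the functional `-w 0` grows by at most `mu`, as normals of polar bodies pair to
at most 1, and it has to climb from `-a` to `a`. -/
theorem two_mul_le_sum (hP : IsPolarPair W V) (h : IsOrbit W V a b q p w v lam mu) {m : ℕ}
    (hm : q m = -q 0) : 2 * a ≤ ∑ j ∈ Finset.range m, mu j := by
  have key : ∀ m, (inner ℝ (-w 0) (q m) : ℝ) ≤ -a + ∑ j ∈ Finset.range m, mu j := by
    intro m
    induction m with
    | zero => simp [h.level_q]
    | succ m ih =>
      rw [Finset.sum_range_succ, h.q_succ, inner_add_right, inner_smul_right]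
      have h1 := hP.inner_le_one _ (hP.left.neg_mem _ (h.active_q 0).1) _ (h.active_p (m + 1)).1
      have h2 := mul_le_of_le_one_right (h.mu_pos m).le h1
      linarith
  have := key m
  rw [hm, inner_neg_neg, h.level_q] at this
  linarith

/-- A shift `d ≤ n` preserving the route would bring the orbit to the antipode after `n - d` bounces
already, with less than the necessary length `2 * a`. -/
theorem isSimpleTrajectory (hP : IsPolarPair W V) (hA : HasAntipodalOrbits W V)
    (h : IsOrbit W V a b q p w v lam mu) : IsSimpleTrajectory (2 * n) q := by
  have ha := h.level_q_pos hP.left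
  have hne : q 0 ≠ -q 0 := fun h0 => by
    have h1 := h.level_q 0
    have h2 := h.level_q 0
    rw [h0, inner_neg_right] at h2
    linarith
  have main : ∀ d, 0 < d → d ≤ n → (∀ i, q (i + d) = q i) → False := by
    intro d hd hdn hper
    have hq : q (n - d) = -q 0 := by
      rw [← hper (n - d), Nat.sub_add_cancel hdn]
      simpa using (h.half_period hA 0).1
    have h1 := h.two_mul_le_sum hP hq
    have h2 := (h.half_period hA 0).2.2
    simp only [zero_add] at h2
    have h3 : ∑ j ∈ Finset.range (n - d), mu j < ∑ j ∈ Finset.range n, mu j :=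
      Finset.sum_lt_sum_of_subset (Finset.range_subset_range.2 (by omega))
        (Finset.mem_range.2 (by omega : n - d < n)) (by simp) (h.mu_pos _)
        fun j _ _ => (h.mu_pos j).le
    linarith
  intro d hd hdn
  by_contra! hper
  rcases le_or_gt d n with hle | hlt
  · exact main d hd hle hper
  -- As `2 * n` is a period, the complementary shift preserves the route as well.
  · refine main (2 * n - d) (by omega) (by omega) fun i => ?_
    have h1 := h.half_period hA i
    have h2 := h.half_period hA (i + n)
    rw [← hper (i + (2 * n - d)), show i + (2 * n - d) + d = i + n + n by omega, h2.1, h1.1, neg_neg]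

end IsOrbit

theorem IsPolarPair.exists_trajectory (hn : 0 < n) (hP : IsPolarPair W V)
    (hA : HasAntipodalOrbits W V) {q₀ p₀ : EuclideanSpace ℝ (Fin n)} (hq : IsGeneric q₀)
    (hp : IsGeneric p₀) (h : IsAdmissiblePosition (vertexPolar W) (vertexPolar V) q₀ p₀) :
    ∃ (q p : ℕ → EuclideanSpace ℝ (Fin n)) (m : ℕ),
      Generates (vertexPolar W) (vertexPolar V) q₀ p₀ q p ∧ IsClosedTrajectory m q p ∧
      IsSimpleTrajectory m q ∧ closedLength (vertexPolar V) m q = 4 := by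
  obtain ⟨⟨hqf, -⟩, hpf, ε, hε, hin⟩ := h
  obtain ⟨w₀, hw⟩ := hP.left.exists_isActive q₀
  obtain ⟨v₀, hv⟩ := hP.right.exists_isActive p₀
  have hw1 := hw.inner_eq_one hP.left hqf
  have hv1 := hv.inner_eq_one hP.right hpf
  rw [hP.outerNormal_eq hq hw] at hin
  -- Moving along `-w₀` from the facet of `v₀` enters the interior, so `⟨v₀, ·⟩` must drop below 1.
  have hvw : 0 < (inner ℝ v₀ w₀ : ℝ) := by
    have h1 := inner_lt_one_of_mem_interior hv.1 (hP.right.ne_zero _ hv.1)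
      (hin (ε / 2) (by linarith) (by linarith))
    rw [inner_sub_right, inner_smul_right, hv1] at h1
    exact pos_of_mul_pos_right (by linarith : 0 < ε / 2 * (inner ℝ v₀ w₀ : ℝ)) (by linarith)
  obtain ⟨q, p, w, v, lam, mu, ho, hq0, hp0, -, -⟩ :=
    exists_isOrbit hP.left hP.right hq hp hw hv hvw
  rw [hw1, hv1] at ho
  refine ⟨q, p, 2 * n, ⟨⟨ho.isClassicalTrajectory hP, hq0, hp0⟩, fun q' p' h' hq' hp' => ?_⟩,
    ho.isClosedTrajectory hn hA, ho.isSimpleTrajectory hP hA, ho.closedLength_eq hP hA⟩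
  have := ho.unique hP h' (hq'.trans hq0.symm) (hp'.trans hp0.symm)
  exact ⟨funext fun i => (this i).1, funext fun i => (this i).2⟩

end Geometry

end

/-! ### Almost all positions are generic -/

noncomputable section

variable {n k l : ℕ}

/-- The triangular witnesses `x`, `y`, `z` make the three functionals independent: each further
kernel lowers the dimension. -/
theorem dimH_add_three_le {F : Type*} [NormedAddCommGroup F] [NormedSpace ℝ F]
    [FiniteDimensional ℝ F] (f g h : F →ₗ[ℝ] ℝ) (α β γ : ℝ) {x y z : F} (hx : f x ≠ 0)
    (hy : f y = 0) (hy' : g y ≠ 0) (hz : f z = 0) (hz' : g z = 0) (hz'' : h z ≠ 0)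
    {d : ℕ} (hd : Module.finrank ℝ F ≤ d + 3) :
    dimH {u | f u = α ∧ g u = β ∧ h u = γ} ≤ d := by
  set S := {u | f u = α ∧ g u = β ∧ h u = γ}
  rcases S.eq_empty_or_nonempty with h0 | h0
  · rw [h0, dimH_empty]
    exact zero_le
  have hconv : Convex ℝ S := by
    rintro a ⟨a1, a2, a3⟩ b ⟨b1, b2, b3⟩ s t - - hst
    refine ⟨?_, ?_, ?_⟩ <;>
      simp only [map_add, map_smul, smul_eq_mul, a1, a2, a3, b1, b2, b3, ← add_mul, hst, one_mul]
  have hspan : vectorSpan ℝ S ≤ f.ker ⊓ g.ker ⊓ h.ker := by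
    rw [vectorSpan, Submodule.span_le]
    rintro _ ⟨a, ⟨a1, a2, a3⟩, b, ⟨b1, b2, b3⟩, rfl⟩
    simp [a1, a2, a3, b1, b2, b3]
  have h1 : f.ker < ⊤ := lt_top_iff_ne_top.2 fun h => hx (by
    have : x ∈ f.ker := h ▸ Submodule.mem_top
    simpa using this)
  have h2 : f.ker ⊓ g.ker < f.ker := by
    refine SetLike.lt_iff_le_and_exists.2 ⟨inf_le_left, y, hy, fun h => hy' ?_⟩
    exact h.2
  have h3 : f.ker ⊓ g.ker ⊓ h.ker < f.ker ⊓ g.ker :=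
    SetLike.lt_iff_le_and_exists.2 ⟨inf_le_left, z, Submodule.mem_inf.2 ⟨hz, hz'⟩,
      fun h => hz'' (Submodule.mem_inf.1 h).2⟩
  have e0 := Submodule.finrank_mono hspan
  have e1 := Submodule.finrank_lt_finrank_of_lt h1
  have e2 := Submodule.finrank_lt_finrank_of_lt h2
  have e3 := Submodule.finrank_lt_finrank_of_lt h3
  rw [finrank_top] at e1
  rw [Real.Convex.dimH_eq_finrank_vectorSpan hconv h0]
  exact_mod_cast (by omega : Module.finrank ℝ (vectorSpan ℝ S) ≤ d)

theorem hausdorffMeasure_eq_zero_of_le {X : Type*} [EMetricSpace X] [MeasurableSpace X]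
    [BorelSpace X] {s : Set X} {d : ℕ} (h : dimH s ≤ d) {r : ℝ} (hr : (d : ℝ) < r) :
    Measure.hausdorffMeasure r s = 0 := by
  have hr0 : 0 ≤ r := (Nat.cast_nonneg d).trans hr.le
  lift r to NNReal using hr0
  refine hausdorffMeasure_of_dimH_lt (h.trans_lt ?_)
  exact_mod_cast hr

/-- The values at `q` show that `c` is not a multiple of `w`; the witness is the part of `c`
orthogonal to `w`, scaled by `⟨w, w⟩`. -/
theorem exists_inner_eq_zero_of_inner_eq {w c q : EuclideanSpace ℝ (Fin n)} (hc : c ≠ 0)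
    (hw : inner ℝ w q = (1 : ℝ)) (hcq : inner ℝ c q = (0 : ℝ)) :
    ∃ z, inner ℝ w z = (0 : ℝ) ∧ (inner ℝ c z : ℝ) ≠ 0 := by
  have hww : 0 < (inner ℝ w w : ℝ) := real_inner_self_pos.2 fun h => by simp [h] at hw
  set z := (inner ℝ w w : ℝ) • c - (inner ℝ w c : ℝ) • w with hz
  have h1 : (inner ℝ w z : ℝ) = 0 := by
    rw [hz, inner_sub_right, inner_smul_right, inner_smul_right]
    ring
  refine ⟨z, h1, fun h2 => ?_⟩
  have h3 : (inner ℝ z z : ℝ) = 0 := by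
    nth_rw 1 [hz]
    rw [inner_sub_left, inner_smul_left, inner_smul_left, h1, h2]
    simp
  have h4 : z = 0 := inner_self_eq_zero.1 h3
  have h5 := congrArg (fun x => (inner ℝ x q : ℝ)) h4
  simp only [hz, inner_sub_left, inner_smul_left, RCLike.conj_to_real, hw, hcq,
    inner_zero_left] at h5
  have h6 : (inner ℝ w c : ℝ) = 0 := by linarith
  rw [hz, h6, zero_smul, sub_zero] at h4
  exact hc ((smul_eq_zero.1 h4).resolve_left hww.ne')

theorem countable_intLattice (n : ℕ) : (intLattice n :
    Set (EuclideanSpace ℝ (Fin n))).Countable := by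
  refine (countable_range fun z : Fin n → ℤ =>
    (WithLp.toLp 2 fun i => (z i : ℝ) : EuclideanSpace ℝ (Fin n))).mono fun x hx => ?_
  choose z hz using mem_intLattice.1 hx
  refine ⟨z, ?_⟩
  ext i
  exact (hz i).symm

/-- The first factor of a point of a product of two hyperplanes is orthogonal to a given vector
only on a set of codimension one. -/
theorem hausdorffMeasure_nongeneric_left {w v c : EuclideanSpace ℝ (Fin n)} (hv : v ≠ 0)
    (hc : c ≠ 0) : Measure.hausdorffMeasure (2 * (n : ℝ) - 2)
      {x : EuclideanSpace ℝ (Fin n) × EuclideanSpace ℝ (Fin n) |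
        inner ℝ v x.2 = (1 : ℝ) ∧ inner ℝ w x.1 = (1 : ℝ) ∧ inner ℝ c x.1 = (0 : ℝ)} = 0 := by
  rcases eq_empty_or_nonempty {x : EuclideanSpace ℝ (Fin n) × EuclideanSpace ℝ (Fin n) |
    inner ℝ v x.2 = (1 : ℝ) ∧ inner ℝ w x.1 = (1 : ℝ) ∧ inner ℝ c x.1 = (0 : ℝ)}
      with h | ⟨x, -, h1, h2⟩
  · rw [h, measure_empty]
  obtain ⟨z, hz, hz'⟩ := exists_inner_eq_zero_of_inner_eq hc h1 h2
  have hw : w ≠ 0 := fun h => by simp [h] at h1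
  -- In dimension 1 the equations at `x` are incompatible with `c ≠ 0`. The bound keeps the
  -- truncated difference `2 * n - 3` honest.
  have hn : 2 ≤ n := by
    by_contra! hlt
    interval_cases n
    · exact hc (Subsingleton.elim _ _)
    · have e1 : x.1 0 * w 0 = 1 := by rwa [← inner_fin_one]
      have e2 : z 0 * w 0 = 0 := by rwa [← inner_fin_one]
      rcases mul_eq_zero.1 e2 with h | h
      · exact hz' (by rw [inner_fin_one, h, zero_mul])
      · simp [h] at e1
  have hd : Module.finrank ℝ (EuclideanSpace ℝ (Fin n) × EuclideanSpace ℝ (Fin n)) ≤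
      2 * n - 3 + 3 := by
    rw [Module.finrank_prod, finrank_euclideanSpace_fin]
    omega
  have hdim := dimH_add_three_le
    ((innerₛₗ ℝ v).comp (LinearMap.snd ℝ (EuclideanSpace ℝ (Fin n)) (EuclideanSpace ℝ (Fin n))))
    ((innerₛₗ ℝ w).comp (LinearMap.fst ℝ (EuclideanSpace ℝ (Fin n)) (EuclideanSpace ℝ (Fin n))))
    ((innerₛₗ ℝ c).comp (LinearMap.fst ℝ (EuclideanSpace ℝ (Fin n)) (EuclideanSpace ℝ (Fin n))))
    1 1 0 (x := (0, v)) (y := (w, 0)) (z := (z, 0)) (by simpa using hv) (by simp)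
    (by simpa using hw) (by simp) (by simpa using hz) (by simpa using hz') hd
  simp only [LinearMap.comp_apply, LinearMap.fst_apply, LinearMap.snd_apply, innerₛₗ_apply_apply]
    at hdim
  refine hausdorffMeasure_eq_zero_of_le hdim ?_
  rw [Nat.cast_sub (by omega)]
  push_cast
  linarith

theorem hausdorffMeasure_nongeneric_right {w v c : EuclideanSpace ℝ (Fin n)} (hw : w ≠ 0)
    (hc : c ≠ 0) : Measure.hausdorffMeasure (2 * (n : ℝ) - 2)
      {x : EuclideanSpace ℝ (Fin n) × EuclideanSpace ℝ (Fin n) |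
        inner ℝ w x.1 = (1 : ℝ) ∧ inner ℝ v x.2 = (1 : ℝ) ∧ inner ℝ c x.2 = (0 : ℝ)} = 0 := by
  have e : Isometry (Prod.swap : EuclideanSpace ℝ (Fin n) × EuclideanSpace ℝ (Fin n) → _) :=
    fun x y => by simp [Prod.edist_eq, max_comm]
  rw [← hausdorffMeasure_nongeneric_left (w := v) hw hc, ← e.hausdorffMeasure_image
    (Or.inr Prod.swap_surjective)]
  congr 1
  rw [image_swap_eq_preimage_swap]
  rfl

/-- Finitely many products of two facet hyperplanes cover the boundaries, and the integral relations
`c` are countable. -/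
theorem ae_boundaryMeasure_isGeneric {W V : Set (EuclideanSpace ℝ (Fin n))} (hW : IsVertexSet W)
    (hV : IsVertexSet V) :
    ∀ᵐ x ∂(boundaryMeasure (vertexPolar W) (vertexPolar V)), IsGeneric x.1 ∧ IsGeneric x.2 := by
  have hmeas : MeasurableSet (frontier (vertexPolar W) ×ˢ frontier (vertexPolar V)) :=
    isClosed_frontier.measurableSet.prod isClosed_frontier.measurableSet
  rw [boundaryMeasure, ae_restrict_iff' hmeas]
  have hcount := countable_intLattice n
  have hall : ∀ᵐ x ∂(Measure.hausdorffMeasure (2 * (n : ℝ) - 2) :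
      Measure (EuclideanSpace ℝ (Fin n) × EuclideanSpace ℝ (Fin n))),
      ∀ w ∈ W, ∀ v ∈ V, ∀ c ∈ (intLattice n : Set (EuclideanSpace ℝ (Fin n))), c ≠ 0 →
        ¬(inner ℝ v x.2 = (1 : ℝ) ∧ inner ℝ w x.1 = (1 : ℝ) ∧ inner ℝ c x.1 = (0 : ℝ)) ∧
        ¬(inner ℝ w x.1 = (1 : ℝ) ∧ inner ℝ v x.2 = (1 : ℝ) ∧ inner ℝ c x.2 = (0 : ℝ)) := by
    refine (ae_ball_iff hW.finite.countable).2 fun w hw => (ae_ball_iff hV.finite.countable).2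
      fun v hv => (ae_ball_iff hcount).2 fun c _ => ?_
    by_cases hc : c = 0
    · simp [hc]
    have h1 := hausdorffMeasure_nongeneric_left (w := w) (hV.ne_zero v hv) hc
    have h2 := hausdorffMeasure_nongeneric_right (v := v) (hW.ne_zero w hw) hc
    filter_upwards [measure_eq_zero_iff_ae_notMem.1 h1, measure_eq_zero_iff_ae_notMem.1 h2]
      with x hx hx' _ using ⟨hx, hx'⟩
  filter_upwards [hall] with x hx hxf
  obtain ⟨-, w, hw, hwx⟩ := (mem_frontier_vertexPolar hW).1 hxf.1
  obtain ⟨-, v, hv, hvx⟩ := (mem_frontier_vertexPolar hV).1 hxf.2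
  constructor
  · intro c hc h0
    by_contra hne
    exact (hx w hw v hv c hc hne).1 ⟨hvx, hwx, h0⟩
  · intro c hc h0
    by_contra hne
    exact (hx w hw v hv c hc hne).2 ⟨hwx, hvx, h0⟩

end

end Billiard

theorem mainTheorem6 {n : ℕ} {H : Set (EuclideanSpace ℝ (Fin n))}
    (hH : Billiard.IsHannerPolytope n H) :
    ∀ᵐ x ∂(Billiard.boundaryMeasure H (Billiard.polarBody H)),
      Billiard.IsAdmissiblePosition H (Billiard.polarBody H) x.1 x.2 →
        ∃ (q p : ℕ → EuclideanSpace ℝ (Fin n)) (m : ℕ),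
          Billiard.Generates H (Billiard.polarBody H) x.1 x.2 q p ∧
          Billiard.IsClosedTrajectory m q p ∧
          Billiard.IsSimpleTrajectory m q ∧
          Billiard.closedLength (Billiard.polarBody H) m q = 4 := by
  obtain ⟨hn, W, V, hP, hA, rfl⟩ := hH.exists_vertices
  rw [hP.polarBody_vertexPolar]
  filter_upwards [Billiard.ae_boundaryMeasure_isGeneric hP.left hP.right] with x hx hadm
  exact hP.exists_trajectory hn hA hx.1 hx.2 hadm
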